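/- Fix a signature $\Sigma$ of function symbols of finite arity and an infinite set of variables. Let $\mathrm{Ter}(\Sigma)$ be the set of finite terms and $\mathrm{Ter}^\infty(\Sigma)$ the set of finite and infinite terms. An infinitary term rewriting system (iTRS) over $\Sigma$ is a set $R$ of rules $\ell\to r$ with $\ell\in\mathrm{Ter}(\Sigma)$ not a variable, $r\in\mathrm{Ter}^\infty(\Sigma)$, and every variable of $r$ occurring in $\ell$. It is *weakly orthogonal* if every rule is left-linear (no variable occurs more than once in $\ell$) and every critical pair $\langle t_1,t_2\rangle$ is trivial, i.e. $t_1\equiv t_2$. A rule $\ell\to r$ is *collapsing* if $r$ is a variable. A rewrite step $s\to t$ replaces a subterm $\ell\sigma$ of $s$ by $r\sigma$, where $\ell\to r$ is in $R$ and $\sigma$ maps variables to terms in $\mathrm{Ter}^\infty(\Sigma)$; its depth is the length of the position of that subterm. Write $s\to^\infty t$ if there is a strongly convergent rewrite sequence from $s$ to $t$ of some ordinal length $\alpha$, i.e. terms $(s_\beta)_{\beta\le\alpha}$ with $s_0=s$, $s_\alpha=t$ and steps $s_\beta\to s_{\beta+1}$ for $\beta<\alpha$, such that for every limit ordinal $\lambda\le\alpha$,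 as $\beta$ tends to $\lambda$ from below, $s_\beta$ converges to $s_\lambda$ (for every $d$, the terms eventually agree with $s_\lambda$ at all positions of depth less than $d$) and the depth of the step $s_\beta\to s_{\beta+1}$ tends to infinity. **Theorem.** Let $R$ be a weakly orthogonal iTRS without collapsing rules. Then $R$ is infinitarily confluent ($\mathrm{CR}^\infty$): for all $s,t_1,t_2\in\mathrm{Ter}^\infty(\Sigma)$ with $s\to^\infty t_1$ and $s\to^\infty t_2$ there is $u\in\mathrm{Ter}^\infty(\Sigma)$ with $t_1\to^\infty u$ and $t_2\to^\infty u$. Consequently $R$ has unique infinitary normal forms ($\mathrm{UN}^\infty$): if $s\to^\infty t_1$ and $s\to^\infty t_2$, where $t_1$ and $t_2$ are (finite or infinite) normal forms, i.e. admit no rewrite step, then $t_1\equiv t_2$. -/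

import Mathlib

namespace InfRewriting

universe u v

/-- A signature: function symbols, each with a finite arity. -/
structure Signature where
  Symb : Type u
  arity : Symb → ℕ

/-- Finite terms over the signature `S` with variables in `V`. -/
inductive Term (S : Signature.{u}) (V : Type v) : Type (max u v)
  | var (x : V) : Term S V
  | app (f : S.Symb) (ts : Fin (S.arity f) → Term S V) : Term S V

/-- Finite and infinite terms, as partial functions from positions to symbols. A position is a
list of argument indices, read from the root (arguments are numbered from `0`); `sym p` is the
symbol at `p`, and is `none` if `p` is not a position of the term. -/
@[ext]
structure ITerm (S : Signature.{u}) (V : Type v) where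
  sym : List ℕ → Option (S.Symb ⊕ V)
  root : (sym []).isSome
  child : ∀ (p : List ℕ) (i : ℕ),
    (sym (p ++ [i])).isSome ↔ ∃ f : S.Symb, sym p = some (Sum.inl f) ∧ i < S.arity f

variable {S : Signature.{u}} {V : Type v}

namespace Term

/-- The symbol at a position of a finite term. -/
def sym : Term S V → List ℕ → Option (S.Symb ⊕ V)
  | var x, [] => some (Sum.inr x)
  | var _, _ :: _ => none
  | app f _, [] => some (Sum.inl f)
  | app f ts, i :: p => if h : i < S.arity f then (ts ⟨i, h⟩).sym p else none

theorem sym_root (t : Term S V) : (t.sym []).isSome := by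
  cases t <;> simp [sym]

theorem sym_child (t : Term S V) (p : List ℕ) (i : ℕ) :
    (t.sym (p ++ [i])).isSome ↔ ∃ f : S.Symb, t.sym p = some (Sum.inl f) ∧ i < S.arity f := by
  induction t generalizing p with
  | var x => cases p <;> simp [sym]
  | app f ts ih =>
    cases p with
    | nil =>
      by_cases h : i < S.arity f <;> simp [sym, h, sym_root]
    | cons j p =>
      by_cases h : j < S.arity f
      · simpa [sym, h] using ih ⟨j, h⟩ p
      · simp [sym, h]

/-- A finite term, seen as an element of the set of finite and infinite terms. -/
def toITerm (t : Term S V) : ITerm S V where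
  sym := t.sym
  root := t.sym_root
  child := t.sym_child

/-- Application of a substitution of finite terms for variables. -/
def subst (σ : V → Term S V) : Term S V → Term S V
  | var x => σ x
  | app f ts => app f fun i => (ts i).subst σ

/-- The subterm at a position, `none` if there is no such position. -/
def subtermAt : Term S V → List ℕ → Option (Term S V)
  | t, [] => some t
  | var _, _ :: _ => none
  | app f ts, i :: p => if h : i < S.arity f then (ts ⟨i, h⟩).subtermAt p else none

/-- The set of variables that occur in a finite term. -/
def vars (t : Term S V) : Set V := {x | ∃ p, t.sym p = some (Sum.inr x)}

/-- No variable has more than one occurrence. -/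
def Linear (t : Term S V) : Prop :=
  ∀ (x : V) (p q : List ℕ), t.sym p = some (Sum.inr x) → t.sym q = some (Sum.inr x) → p = q

/-- `σ` is a most general unifier of `s` and `t`. -/
def IsMGU (σ : V → Term S V) (s t : Term S V) : Prop :=
  s.subst σ = t.subst σ ∧
    ∀ τ : V → Term S V, s.subst τ = t.subst τ →
      ∃ θ : V → Term S V, ∀ x, τ x = (σ x).subst θ

end Term

namespace ITerm

/-- The set of variables that occur in a term. -/
def vars (t : ITerm S V) : Set V := {x | ∃ p, t.sym p = some (Sum.inr x)}

/-- Symbols of the instance by `σ` of a (possibly empty) tree with symbols `s`: walk down `s` and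
continue in `σ x` once a variable `x` is met. -/
def substSym (σ : V → ITerm S V) :
    (List ℕ → Option (S.Symb ⊕ V)) → List ℕ → Option (S.Symb ⊕ V)
  | s, [] =>
    match s [] with
    | some (Sum.inr x) => (σ x).sym []
    | o => o
  | s, i :: p =>
    match s [] with
    | some (Sum.inr x) => (σ x).sym (i :: p)
    | _ => substSym σ (fun q => s (i :: q)) p

theorem substSym_nil_isSome (σ : V → ITerm S V) (s : List ℕ → Option (S.Symb ⊕ V)) :
    (substSym σ s []).isSome = (s []).isSome := by
  rcases h : s [] with _ | f | x <;> simp [substSym, h, (σ _).root]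

theorem substSym_child (σ : V → ITerm S V) (p : List ℕ) :
    ∀ (s : List ℕ → Option (S.Symb ⊕ V)),
      (∀ (p : List ℕ) (i : ℕ), (s (p ++ [i])).isSome ↔
        ∃ f : S.Symb, s p = some (Sum.inl f) ∧ i < S.arity f) →
      ∀ i : ℕ, (substSym σ s (p ++ [i])).isSome ↔
        ∃ f : S.Symb, substSym σ s p = some (Sum.inl f) ∧ i < S.arity f := by
  induction p with
  | nil =>
    intro s hs i
    have h1 := hs [] i
    rcases h : s [] with _ | f | x
    · have h2 := substSym_nil_isSome σ (fun q => s (i :: q))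
      simp_all [substSym]
    · have h2 := substSym_nil_isSome σ (fun q => s (i :: q))
      simp_all [substSym]
    · simpa [substSym, h] using (σ x).child [] i
  | cons j p ih =>
    intro s hs i
    have h1 := ih (fun q => s (j :: q)) (fun p i => hs (j :: p) i) i
    rcases h : s [] with _ | f | x
    · simpa [substSym, h] using h1
    · simpa [substSym, h] using h1
    · simpa [substSym, h] using (σ x).child (j :: p) i

/-- Application of a substitution of (finite or infinite) terms for variables. -/
def subst (σ : V → ITerm S V) (t : ITerm S V) : ITerm S V where
  sym := substSym σ t.sym
  root := by rw [substSym_nil_isSome]; exact t.root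
  child p i := substSym_child σ p t.sym t.child i

/-- `p` is a position of `s`, and `v` is the subterm of `s` at `p`. -/
def IsSubtermAt (s : ITerm S V) (p : List ℕ) (v : ITerm S V) : Prop :=
  ∀ q, s.sym (p ++ q) = v.sym q

/-- The term that results from `s` by putting `v` at position `p` of `s`
(and `s` itself if `s` has no such position). -/
def replaceAt (s : ITerm S V) (p : List ℕ) (v : ITerm S V) : ITerm S V :=
  if hp : (s.sym p).isSome then
    { sym := fun q => if p <+: q then v.sym (q.drop p.length) else s.sym q
      root := by
        by_cases h : p <+: []
        · simpa [List.prefix_nil.mp h] using v.root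
        · simpa [h] using s.root
      child := by
        intro q i
        by_cases h : p <+: q
        · obtain ⟨r, rfl⟩ := h
          have h2 : p <+: p ++ r ++ [i] := by simp
          rw [if_pos h2, if_pos (List.prefix_append p r)]
          simpa using v.child r i
        · by_cases h2 : p <+: q ++ [i]
          · have h3 : p = q ++ [i] := (List.prefix_concat_iff.mp h2).resolve_right h
            subst h3
            rw [if_pos h2, if_neg h]
            have h4 := (s.child q i).mp hp
            simpa [v.root] using h4
          · rw [if_neg h2, if_neg h]
            exact s.child q i }
  else s

/-- `s` and `t` have the same symbols at all positions of depth less than `d`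
(that is, their distance is at most `2 ^ (-d)` in the usual metric on infinite terms). -/
def AgreeBelow (d : ℕ) (s t : ITerm S V) : Prop :=
  ∀ q : List ℕ, q.length < d → s.sym q = t.sym q

end ITerm

/-- An infinitary rewrite rule: the left-hand side is a finite term and no variable, the
right-hand side is a finite or infinite term all of whose variables occur on the left. -/
structure Rule (S : Signature.{u}) (V : Type v) where
  lhs : Term S V
  rhs : ITerm S V
  lhs_ne_var : ∀ x : V, lhs ≠ Term.var x
  rhs_vars : rhs.vars ⊆ lhs.vars

/-- A rule is collapsing if its right-hand side is a variable. -/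
def Rule.Collapsing (ρ : Rule S V) : Prop := ∃ x : V, ρ.rhs = (Term.var x).toITerm

/-- An infinitary term rewriting system over the signature `S`: a set of rules. -/
abbrev ITRS (S : Signature.{u}) (V : Type v) := Set (Rule S V)

/-- The renaming of the variables of a finite term along a permutation of the variables. -/
def Term.rename (e : Equiv.Perm V) (t : Term S V) : Term S V :=
  t.subst fun x => Term.var (e x)

/-- The renaming of the variables of a term along a permutation of the variables. -/
def ITerm.rename (e : Equiv.Perm V) (t : ITerm S V) : ITerm S V :=
  t.subst fun x => (Term.var (e x)).toITerm

/-- `(t₁, t₂)` is a critical pair of `R`. There are rules `ρ₁`, `ρ₂` of `R`, the latter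
renamed by `e` so that it has no variable in common with the former, such that the subterm at a
non-variable position `p` of the left-hand side of `ρ₁` unifies with the left-hand side of `ρ₂`,
with most general unifier `σ`; then `t₁` and `t₂` are the results of contracting in the
`σ`-instance of the left-hand side of `ρ₁` the redex of `ρ₂` at `p` and the redex of `ρ₁` at the
root. The overlap of a rule with itself at the root does not count. -/
def IsCriticalPair (R : ITRS S V) (t₁ t₂ : ITerm S V) : Prop :=
  ∃ ρ₁ ∈ R, ∃ ρ₂ ∈ R, ∃ (e : Equiv.Perm V) (p : List ℕ) (f : S.Symb)
    (ts : Fin (S.arity f) → Term S V) (σ : V → Term S V),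
    Disjoint ρ₁.lhs.vars (ρ₂.lhs.rename e).vars ∧
    ¬ (p = [] ∧ ρ₁ = ρ₂) ∧
    ρ₁.lhs.subtermAt p = some (Term.app f ts) ∧
    Term.IsMGU σ (Term.app f ts) (ρ₂.lhs.rename e) ∧
    t₁ = (ρ₁.lhs.subst σ).toITerm.replaceAt p
      ((ρ₂.rhs.rename e).subst fun x => (σ x).toITerm) ∧
    t₂ = ρ₁.rhs.subst fun x => (σ x).toITerm

/-- All rules are left-linear and all critical pairs are trivial. -/
def WeaklyOrthogonal (R : ITRS S V) : Prop :=
  (∀ ρ ∈ R, ρ.lhs.Linear) ∧ ∀ t₁ t₂ : ITerm S V, IsCriticalPair R t₁ t₂ → t₁ = t₂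

/-- A rewrite step `s → t` at position `p`: for a rule of `R` and a substitution `σ`, the subterm
of `s` at `p` is the `σ`-instance of the left-hand side, and it is replaced by that of the
right-hand side. The depth of the step is the length of `p`. -/
def StepAt (R : ITRS S V) (p : List ℕ) (s t : ITerm S V) : Prop :=
  ∃ ρ ∈ R, ∃ σ : V → ITerm S V,
    s.IsSubtermAt p (ρ.lhs.toITerm.subst σ) ∧ t = s.replaceAt p (ρ.rhs.subst σ)

/-- The terms `s β` (`β ≤ α`) and the positions `p β` (`β < α`) form a strongly convergent rewrite
sequence of length `α`: there is a step from `s β` to `s (β + 1)` at `p β` for every `β < α`, and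
at every limit ordinal `l ≤ α` the depths of the steps before `l` tend to infinity and the terms
before `l` converge to `s l`. -/
structure IsStronglyConvergent (R : ITRS S V) (α : Ordinal.{0})
    (s : Ordinal.{0} → ITerm S V) (p : Ordinal.{0} → List ℕ) : Prop where
  step : ∀ β < α, StepAt R (p β) (s β) (s (β + 1))
  limit : ∀ l ≤ α, Order.IsSuccLimit l → ∀ d : ℕ, ∃ β < l, ∀ γ, β ≤ γ → γ < l →
    d ≤ (p γ).length ∧ (s γ).AgreeBelow d (s l)

/-- Infinitary reduction: `t` is reached from `s` by a strongly convergent rewrite sequence of some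
ordinal length. (Such sequences have countable length, so that the ordinals in `Ordinal.{0}` are
enough.) -/
def InfReduces (R : ITRS S V) (s t : ITerm S V) : Prop :=
  ∃ (α : Ordinal.{0}) (u : Ordinal.{0} → ITerm S V) (p : Ordinal.{0} → List ℕ),
    IsStronglyConvergent R α u p ∧ u 0 = s ∧ u α = t

/-- Infinitary confluence. -/
def CRinf (R : ITRS S V) : Prop :=
  ∀ s t₁ t₂ : ITerm S V, InfReduces R s t₁ → InfReduces R s t₂ →
    ∃ u : ITerm S V, InfReduces R t₁ u ∧ InfReduces R t₂ u

/-- A (finite or infinite) normal form: a term without rewrite steps. -/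
def IsNormalForm (R : ITRS S V) (t : ITerm S V) : Prop :=
  ¬ ∃ (p : List ℕ) (t' : ITerm S V), StepAt R p t t'

/-- Uniqueness of infinitary normal forms. -/
def UNinf (R : ITRS S V) : Prop :=
  ∀ s t₁ t₂ : ITerm S V, InfReduces R s t₁ → InfReduces R s t₂ →
    IsNormalForm R t₁ → IsNormalForm R t₂ → t₁ = t₂

end InfRewriting

/-!
Weakly orthogonal infinitary rewriting without collapsing rules is confluent because parallel steps,
which contract any set of redexes at pairwise parallel positions, have the diamond property and keep
what happens below the root below the root.

Infinitary reduction is used in a coinductive form, `Red`: `s` reduces to `t` if a finite reduction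
leads from `s` to a term that has the root symbol of `t` and whose immediate subterms reduce to those
of `t` in the same sense. By left-linearity and finiteness of left-hand sides, `Red` absorbs a
further step (`Red.tail`), so it is transitive; hence it contains the strongly convergent sequences
of all ordinal lengths (`IsWeakSeq.red`). Conversely, `Red` unfolds to a sequence of length at most
`ω` (`Red.infReduces`).

Triviality of critical pairs carries over to overlapping redexes in infinite terms
(`WeaklyOrthogonal.replaceAt_eq`): the patterns are linear and can be renamed apart, so that they
have a finite most general unifier, through which also infinite unifiers factor. Therefore a
parallel step below the root that overlaps a redex at the root already has the effect of contracting
that redex, followed by the rest of the parallel step. If there is no overlap, the redex at the root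
and the parallel step commute, and the latter stays below the root, since the right-hand side is
not a variable (`WeaklyOrthogonal.lift_par_rootStep`). The diamond property follows by corecursion.

An infinitary reduction can be projected over a parallel step (`WeaklyOrthogonal.red_par`), and if
it is below the root, so is its projection (`WeaklyOrthogonal.lift_red_par`). For two infinitary
reductions of `s`, finite parts of them determine the root symbols of the limits. These parts are
joined in a term `w` by parallel steps, over which the remaining reductions are projected. The
projections are reductions of `w` below the root, so both their limits have the root symbol of `w`.
This is the root symbol of the common reduct; its immediate subterms are obtained in the same way
from those of `w` (`WeaklyOrthogonal.confluent_red`).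
-/

namespace InfRewriting

universe u v w

variable {S : Signature.{u}} {V : Type v}

/-! ### Finite and infinite terms as trees -/

namespace ITerm

theorem sym_append_eq_none (t : ITerm S V) (p q : List ℕ) (h : t.sym p = none) :
    t.sym (p ++ q) = none := by
  induction q using List.reverseRecOn with
  | nil => simpa using h
  | append_singleton q i ih =>
    have h1 := t.child (p ++ q) i
    rw [ih] at h1
    rw [← List.append_assoc]
    simpa using h1

/-- The term that consists of a single variable. -/
def var (x : V) : ITerm S V := (Term.var x).toITerm

/-- The term with root symbol `f` and given immediate subterms. -/
def app (f : S.Symb) (a : Fin (S.arity f) → ITerm S V) : ITerm S V where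
  sym
    | [] => some (Sum.inl f)
    | i :: p => if h : i < S.arity f then (a ⟨i, h⟩).sym p else none
  root := rfl
  child p i := by
    cases p with
    | nil => by_cases h : i < S.arity f <;> simp [h, (a _).root]
    | cons j p =>
      by_cases h : j < S.arity f
      · simpa [h] using (a ⟨j, h⟩).child p i
      · simp [h]

/-- The immediate subterm with number `i`; the term itself if there is none. -/
def arg (t : ITerm S V) (i : ℕ) : ITerm S V :=
  if h : (t.sym [i]).isSome then
    { sym := fun p => t.sym (i :: p)
      root := h
      child := fun p j => t.child (i :: p) j }
  else t

@[simp] theorem sym_var_nil (x : V) : (var x : ITerm S V).sym [] = some (Sum.inr x) := rfl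

@[simp] theorem sym_var_cons (x : V) (i : ℕ) (p : List ℕ) :
    (var x : ITerm S V).sym (i :: p) = none := rfl

@[simp] theorem sym_app_nil (f : S.Symb) (a : Fin (S.arity f) → ITerm S V) :
    (app f a).sym [] = some (Sum.inl f) := rfl

theorem sym_app_cons (f : S.Symb) (a : Fin (S.arity f) → ITerm S V) (i : ℕ) (p : List ℕ) :
    (app f a).sym (i :: p) = if h : i < S.arity f then (a ⟨i, h⟩).sym p else none := rfl

@[simp] theorem sym_app_fin (f : S.Symb) (a : Fin (S.arity f) → ITerm S V)
    (i : Fin (S.arity f)) (p : List ℕ) : (app f a).sym (i.1 :: p) = (a i).sym p := by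
  simp [sym_app_cons]

@[simp] theorem arg_app (f : S.Symb) (a : Fin (S.arity f) → ITerm S V) (i : Fin (S.arity f)) :
    (app f a).arg i.1 = a i := by
  ext1
  funext p
  simp [arg, (a i).root]

theorem app_injective (f : S.Symb) :
    Function.Injective (app f : (Fin (S.arity f) → ITerm S V) → ITerm S V) := by
  intro a b h
  funext i
  rw [← arg_app f a i, h, arg_app]

@[simp] theorem app_inj {f : S.Symb} {a b : Fin (S.arity f) → ITerm S V} :
    app f a = app f b ↔ a = b := (app_injective f).eq_iff

theorem symb_eq_of_app_eq {f g : S.Symb} {a : Fin (S.arity f) → ITerm S V}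
    {b : Fin (S.arity g) → ITerm S V} (h : app f a = app g b) : f = g := by
  simpa using congrArg (fun t => t.sym []) h

@[simp] theorem var_ne_app (x : V) (f : S.Symb) (a : Fin (S.arity f) → ITerm S V) :
    var x ≠ app f a := fun h => by simpa using congrArg (fun t => t.sym []) h

@[simp] theorem app_ne_var (x : V) (f : S.Symb) (a : Fin (S.arity f) → ITerm S V) :
    app f a ≠ var x := (var_ne_app x f a).symm

theorem eq_var_of_sym_nil {t : ITerm S V} {x : V} (h : t.sym [] = some (Sum.inr x)) :
    t = var x := by
  ext1
  funext p
  cases p with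
  | nil => simpa using h
  | cons i p =>
    have h1 := t.child [] i
    rw [h] at h1
    exact sym_append_eq_none t [i] p (by simpa using h1)

theorem eq_app_of_sym_nil {t : ITerm S V} {f : S.Symb} (h : t.sym [] = some (Sum.inl f)) :
    t = app f (fun i => t.arg i.1) := by
  ext1
  funext p
  cases p with
  | nil => simpa using h
  | cons i p =>
    have h1 := t.child [] i
    rw [h] at h1
    simp only [List.nil_append, Option.some.injEq, Sum.inl.injEq, exists_eq_left'] at h1
    by_cases h2 : i < S.arity f
    · simp [sym_app_cons, h2, arg, h1.2 h2]
    · simp only [sym_app_cons, h2, dite_false]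
      exact sym_append_eq_none t [i] p (by simpa [h2] using h1)

theorem eq_var_or_app (t : ITerm S V) :
    (∃ x, t = var x) ∨ ∃ f a, t = app f a := by
  have h := t.root
  rcases h1 : t.sym [] with _ | f | x
  · simp [h1] at h
  · exact Or.inr ⟨f, _, eq_app_of_sym_nil h1⟩
  · exact Or.inl ⟨x, eq_var_of_sym_nil h1⟩

/-- Symbols of the tree unfolded from a state of the coalgebra `c`. A state either stands for a
given term or has a root symbol and successor states. -/
def corecSym {ι : Type w} (c : ι → ITerm S V ⊕ Σ f : S.Symb, Fin (S.arity f) → ι) :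
    ι → List ℕ → Option (S.Symb ⊕ V)
  | i, [] =>
    match c i with
    | Sum.inl t => t.sym []
    | Sum.inr n => some (Sum.inl n.1)
  | i, j :: p =>
    match c i with
    | Sum.inl t => t.sym (j :: p)
    | Sum.inr n => if h : j < S.arity n.1 then corecSym c (n.2 ⟨j, h⟩) p else none

theorem corecSym_nil_isSome {ι : Type w}
    (c : ι → ITerm S V ⊕ Σ f : S.Symb, Fin (S.arity f) → ι) (i : ι) :
    (corecSym c i []).isSome := by
  rcases h : c i with t | n <;> simp [corecSym, h, root]

theorem corecSym_child {ι : Type w}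
    (c : ι → ITerm S V ⊕ Σ f : S.Symb, Fin (S.arity f) → ι) (p : List ℕ) (j : ℕ) :
    ∀ i, (corecSym c i (p ++ [j])).isSome ↔
      ∃ f : S.Symb, corecSym c i p = some (Sum.inl f) ∧ j < S.arity f := by
  induction p with
  | nil =>
    intro i
    rcases h : c i with t | n
    · simpa [corecSym, h] using t.child [] j
    · by_cases h2 : j < S.arity n.1
      · simpa [corecSym, h, h2] using corecSym_nil_isSome c (n.2 ⟨j, h2⟩)
      · simp [corecSym, h, h2]
  | cons k p ih =>
    intro i
    rcases h : c i with t | n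
    · simpa [corecSym, h] using t.child (k :: p) j
    · by_cases h2 : k < S.arity n.1
      · simpa [corecSym, h, h2] using ih _
      · simp [corecSym, h, h2]

/-- Corecursion with choice: if each state `i` either has a solution `t`, given outright by
`T i t`, or can be reduced by `N i f k` to the states `k j`, placed below the symbol `f`, then there
is a choice of terms, one for each state, that follows one of these two options everywhere. -/
theorem exists_corec {ι : Type w} (T : ι → ITerm S V → Prop)
    (N : ι → (f : S.Symb) → (Fin (S.arity f) → ι) → Prop)
    (h : ∀ i, (∃ t, T i t) ∨ ∃ f k, N i f k) :
    ∃ F : ι → ITerm S V, ∀ i, T i (F i) ∨ ∃ f k, N i f k ∧ F i = app f fun j => F (k j) := by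
  have h1 : ∀ i, ∃ c : ITerm S V ⊕ Σ f : S.Symb, Fin (S.arity f) → ι,
      Sum.elim (T i) (fun n => N i n.1 n.2) c := by
    intro i
    rcases h i with ⟨t, ht⟩ | ⟨f, k, hk⟩
    · exact ⟨Sum.inl t, ht⟩
    · exact ⟨Sum.inr ⟨f, k⟩, hk⟩
  choose c hc using h1
  refine ⟨fun i => ⟨corecSym c i, corecSym_nil_isSome c i, fun p j => corecSym_child c p j i⟩,
    fun i => ?_⟩
  have h2 := hc i
  rcases h3 : c i with t | ⟨f, k⟩
  · rw [h3] at h2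
    refine Or.inl ((congrArg (T i) ?_).mpr h2)
    ext1
    funext p
    cases p <;> simp [corecSym, h3]
  · rw [h3] at h2
    refine Or.inr ⟨f, k, h2, ?_⟩
    ext1
    funext p
    cases p <;> simp [corecSym, h3, sym_app_cons]

/-! ### Substitution -/

@[simp] theorem subst_var (σ : V → ITerm S V) (x : V) : (var x).subst σ = σ x := by
  ext1
  funext p
  cases p <;> simp [subst, substSym]

theorem substSym_none (σ : V → ITerm S V) (p : List ℕ) :
    substSym σ (fun _ => none) p = none := by
  induction p with
  | nil => rfl
  | cons i p ih => simpa [substSym] using ih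

@[simp] theorem subst_app (σ : V → ITerm S V) (f : S.Symb) (a : Fin (S.arity f) → ITerm S V) :
    (app f a).subst σ = app f fun i => (a i).subst σ := by
  ext1
  funext p
  cases p with
  | nil => simp [subst, substSym]
  | cons i p =>
    by_cases h : i < S.arity f
    · simp [subst, substSym, sym_app_cons, h]
    · simp [subst, substSym, sym_app_cons, h, substSym_none]

/-- The coinduction principle for equality of terms. -/
theorem eq_of_bisim (X : ITerm S V → ITerm S V → Prop)
    (hX : ∀ a b, X a b → a = b ∨
      ∃ f c d, a = app f c ∧ b = app f d ∧ ∀ i, X (c i) (d i)) {a b : ITerm S V}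
    (h : X a b) : a = b := by
  have key : ∀ p : List ℕ, ∀ a b, X a b → a.sym p = b.sym p := by
    intro p
    induction p with
    | nil =>
      intro a b h
      rcases hX a b h with rfl | ⟨f, c, d, rfl, rfl, -⟩ <;> rfl
    | cons i p ih =>
      intro a b h
      rcases hX a b h with rfl | ⟨f, c, d, rfl, rfl, h2⟩
      · rfl
      · by_cases h3 : i < S.arity f
        · simpa [sym_app_cons, h3] using ih _ _ (h2 ⟨i, h3⟩)
        · simp [sym_app_cons, h3]
  ext1
  funext p
  exact key p a b h

theorem subst_subst (σ τ : V → ITerm S V) (t : ITerm S V) :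
    (t.subst σ).subst τ = t.subst fun x => (σ x).subst τ := by
  refine eq_of_bisim (fun a b => ∃ t : ITerm S V, a = (t.subst σ).subst τ ∧
    b = t.subst fun x => (σ x).subst τ) ?_ ⟨t, rfl, rfl⟩
  rintro _ _ ⟨t, rfl, rfl⟩
  rcases t.eq_var_or_app with ⟨x, rfl⟩ | ⟨f, a, rfl⟩
  · simp
  · exact Or.inr ⟨f, _, _, by simp, by simp, fun i => ⟨a i, rfl, rfl⟩⟩

theorem mem_vars_app {f : S.Symb} {a : Fin (S.arity f) → ITerm S V} {i : Fin (S.arity f)} {x : V}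
    (h : x ∈ (a i).vars) : x ∈ (app f a).vars := by
  obtain ⟨p, hp⟩ := h
  exact ⟨i.1 :: p, by simpa using hp⟩

theorem mem_vars_var (x : V) : x ∈ (var x : ITerm S V).vars := ⟨[], rfl⟩

theorem subst_congr {σ τ : V → ITerm S V} {t : ITerm S V} (h : ∀ x ∈ t.vars, σ x = τ x) :
    t.subst σ = t.subst τ := by
  refine eq_of_bisim (fun a b => ∃ t : ITerm S V, (∀ x ∈ t.vars, σ x = τ x) ∧
    a = t.subst σ ∧ b = t.subst τ) ?_ ⟨t, h, rfl, rfl⟩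
  rintro _ _ ⟨t, h, rfl, rfl⟩
  rcases t.eq_var_or_app with ⟨x, rfl⟩ | ⟨f, a, rfl⟩
  · simp [h x (mem_vars_var x)]
  · exact Or.inr ⟨f, _, _, by simp, by simp,
      fun i => ⟨a i, fun x hx => h x (mem_vars_app hx), rfl, rfl⟩⟩

/-! ### Subterms and replacement -/

theorem isSubtermAt_nil {s v : ITerm S V} : s.IsSubtermAt [] v ↔ s = v := by
  constructor
  · intro h
    ext1
    funext p
    exact h p
  · rintro rfl q
    rfl

theorem isSubtermAt_fin {f : S.Symb} {a : Fin (S.arity f) → ITerm S V} {i : Fin (S.arity f)}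
    {p : List ℕ} {v : ITerm S V} :
    (app f a).IsSubtermAt (i.1 :: p) v ↔ (a i).IsSubtermAt p v := by
  simp [IsSubtermAt]

theorem lt_arity_of_isSubtermAt {f : S.Symb} {a : Fin (S.arity f) → ITerm S V} {i : ℕ}
    {p : List ℕ} {v : ITerm S V} (h : (app f a).IsSubtermAt (i :: p) v) : i < S.arity f := by
  by_contra h1
  have h2 := h []
  have h3 := v.root
  simp [← h2, sym_app_cons, h1] at h3

theorem not_isSubtermAt_var_cons {x : V} {i : ℕ} {p : List ℕ} {v : ITerm S V} :
    ¬ (var x).IsSubtermAt (i :: p) v := by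
  intro h
  have h2 := h []
  have h3 := v.root
  simp [← h2] at h3

theorem IsSubtermAt.unique {s v v' : ITerm S V} {p : List ℕ} (h : s.IsSubtermAt p v)
    (h' : s.IsSubtermAt p v') : v = v' := by
  ext1
  funext q
  rw [← h q, h' q]

theorem replaceAt_nil (s v : ITerm S V) : s.replaceAt [] v = v := by
  ext1
  simp [replaceAt, s.root]

theorem replaceAt_fin (f : S.Symb) (a : Fin (S.arity f) → ITerm S V) (i : Fin (S.arity f))
    (p : List ℕ) (v : ITerm S V) :
    (app f a).replaceAt (i.1 :: p) v = app f (Function.update a i ((a i).replaceAt p v)) := by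
  by_cases h : ((a i).sym p).isSome
  · ext1
    funext q
    cases q with
    | nil => simp [replaceAt, h]
    | cons j q =>
      by_cases hj : j < S.arity f
      · by_cases hij : (⟨j, hj⟩ : Fin (S.arity f)) = i
        · subst hij
          simp [replaceAt, h, sym_app_cons, hj]
        · have hij' : i.1 ≠ j := fun h => hij (Fin.ext h.symm)
          simp [replaceAt, h, sym_app_cons, hj, Function.update_of_ne hij, hij']
      · have hij' : i.1 ≠ j := fun h => hj (h ▸ i.2)
        simp [replaceAt, h, sym_app_cons, hj, hij']
  · simp [replaceAt, h]

theorem AgreeBelow.trans {d : ℕ} {r s t : ITerm S V} (h : AgreeBelow d r s)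
    (h' : AgreeBelow d s t) : AgreeBelow d r t :=
  fun q hq => (h q hq).trans (h' q hq)

theorem AgreeBelow.mono {d e : ℕ} {s t : ITerm S V} (h : AgreeBelow e s t) (hd : d ≤ e) :
    AgreeBelow d s t := fun q hq => h q (hq.trans_le hd)

theorem eq_of_agreeBelow {s t : ITerm S V} (h : ∀ d, AgreeBelow d s t) : s = t := by
  ext1
  funext q
  exact h (q.length + 1) q (Nat.lt_succ_self _)

theorem agreeBelow_app {d : ℕ} {f : S.Symb} {a b : Fin (S.arity f) → ITerm S V} :
    AgreeBelow (d + 1) (app f a) (app f b) ↔ ∀ i, AgreeBelow d (a i) (b i) := by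
  constructor
  · intro h i q hq
    simpa using h (i.1 :: q) (by simpa using hq)
  · intro h q hq
    cases q with
    | nil => rfl
    | cons i q =>
      by_cases hi : i < S.arity f
      · simpa [sym_app_cons, hi] using h ⟨i, hi⟩ q (by simpa using hq)
      · simp [sym_app_cons, hi]

end ITerm

open ITerm

/-! ### Rewrite steps, by recursion on the position -/

/-- `s → t` is an application of the rule `ρ` at the root. -/
def RootStep (ρ : Rule S V) (s t : ITerm S V) : Prop :=
  ∃ σ : V → ITerm S V, s = ρ.lhs.toITerm.subst σ ∧ t = ρ.rhs.subst σ

variable {R : ITRS S V}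

theorem stepAt_nil {s t : ITerm S V} : StepAt R [] s t ↔ ∃ ρ ∈ R, RootStep ρ s t := by
  simp [StepAt, RootStep, isSubtermAt_nil, replaceAt_nil]

theorem stepAt_cons {s t : ITerm S V} {i : ℕ} {p : List ℕ} :
    StepAt R (i :: p) s t ↔ ∃ (f : S.Symb) (a : Fin (S.arity f) → ITerm S V)
      (j : Fin (S.arity f)) (b : ITerm S V), i = j.1 ∧ StepAt R p (a j) b ∧ s = app f a ∧
        t = app f (Function.update a j b) := by
  constructor
  · rintro ⟨ρ, hρ, σ, h1, rfl⟩
    rcases s.eq_var_or_app with ⟨x, rfl⟩ | ⟨f, a, rfl⟩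
    · exact (not_isSubtermAt_var_cons h1).elim
    · have hi := lt_arity_of_isSubtermAt h1
      obtain ⟨j, rfl⟩ : ∃ j : Fin (S.arity f), i = j.1 := ⟨⟨i, hi⟩, rfl⟩
      exact ⟨f, a, j, _, rfl, ⟨ρ, hρ, σ, isSubtermAt_fin.1 h1, rfl⟩, rfl,
        replaceAt_fin f a j p _⟩
  · rintro ⟨f, a, j, b, rfl, ⟨ρ, hρ, σ, h1, rfl⟩, rfl, rfl⟩
    exact ⟨ρ, hρ, σ, isSubtermAt_fin.2 h1, (replaceAt_fin f a j p _).symm⟩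

theorem StepAt.agreeBelow {p : List ℕ} {s t : ITerm S V} (h : StepAt R p s t) :
    AgreeBelow p.length s t := by
  induction p generalizing s t with
  | nil => intro q hq; simp at hq
  | cons i p ih =>
    obtain ⟨f, a, j, b, rfl, h1, rfl, rfl⟩ := stepAt_cons.1 h
    refine agreeBelow_app.2 fun k => ?_
    rcases eq_or_ne k j with rfl | hk
    · simpa using ih h1
    · rw [Function.update_of_ne hk]
      exact fun _ _ => rfl

/-! ### Linear patterns, unification and trivial critical pairs -/

namespace Term

@[simp] theorem toITerm_var (x : V) : (Term.var x : Term S V).toITerm = ITerm.var x := rfl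

@[simp] theorem toITerm_app (f : S.Symb) (ts : Fin (S.arity f) → Term S V) :
    (Term.app f ts).toITerm = ITerm.app f fun i => (ts i).toITerm := by
  ext1
  funext p
  cases p <;> rfl

theorem toITerm_injective : Function.Injective (toITerm : Term S V → ITerm S V) := by
  intro s
  induction s with
  | var x =>
    rintro (y | ⟨g, us⟩) h
    · simpa using congrArg (fun t => t.sym []) h
    · simp at h
  | app f ts ih =>
    rintro (y | ⟨g, us⟩) h
    · simp at h
    · simp only [toITerm_app] at h
      obtain rfl := symb_eq_of_app_eq h
      congr 1
      funext i
      exact ih i (congrFun (ITerm.app_inj.1 h) i)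

theorem toITerm_subst (t : Term S V) (σ : V → Term S V) :
    (t.subst σ).toITerm = t.toITerm.subst fun x => (σ x).toITerm := by
  induction t with
  | var x => simp [subst]
  | app f ts ih => simp [subst, ih]

@[simp] theorem mem_vars_var {x y : V} : x ∈ (var y : Term S V).vars ↔ x = y := by
  constructor
  · rintro ⟨_ | ⟨i, p⟩, hp⟩
    · simpa [sym, eq_comm] using hp
    · simp [sym] at hp
  · rintro rfl
    exact ⟨[], rfl⟩

@[simp] theorem mem_vars_app {x : V} {f : S.Symb} {ts : Fin (S.arity f) → Term S V} :
    x ∈ (app f ts).vars ↔ ∃ i, x ∈ (ts i).vars := by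
  constructor
  · rintro ⟨_ | ⟨i, p⟩, hp⟩
    · simp [sym] at hp
    · by_cases h : i < S.arity f
      · exact ⟨⟨i, h⟩, p, by simpa [sym, h] using hp⟩
      · simp [sym, h] at hp
  · rintro ⟨i, p, hp⟩
    exact ⟨i.1 :: p, by simpa [sym] using hp⟩

theorem vars_finite (t : Term S V) : t.vars.Finite := by
  induction t with
  | var x =>
    refine (Set.finite_singleton x).subset fun y hy => ?_
    simpa using hy
  | app f ts ih =>
    refine (Set.finite_iUnion ih).subset fun y hy => ?_
    simpa using hy

theorem Linear.arg {f : S.Symb} {ts : Fin (S.arity f) → Term S V} (h : (app f ts).Linear)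
    (i : Fin (S.arity f)) : (ts i).Linear := by
  intro x p q hp hq
  have := h x (i.1 :: p) (i.1 :: q) (by simpa [sym] using hp) (by simpa [sym] using hq)
  simpa using this

theorem Linear.eq_of_mem_vars {f : S.Symb} {ts : Fin (S.arity f) → Term S V}
    (h : (app f ts).Linear) {i j : Fin (S.arity f)} {x : V} (hi : x ∈ (ts i).vars)
    (hj : x ∈ (ts j).vars) : i = j := by
  obtain ⟨p, hp⟩ := hi
  obtain ⟨q, hq⟩ := hj
  have := h x (i.1 :: p) (j.1 :: q) (by simpa [sym] using hp) (by simpa [sym] using hq)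
  exact Fin.ext (List.cons.inj this).1

theorem subst_congr {σ τ : V → Term S V} {t : Term S V} (h : ∀ x ∈ t.vars, σ x = τ x) :
    t.subst σ = t.subst τ := by
  induction t with
  | var x => exact h x (by simp)
  | app f ts ih =>
    simp only [subst]
    congr 1
    funext i
    exact ih i fun x hx => h x (mem_vars_app.2 ⟨i, hx⟩)

theorem toITerm_subst_congr {σ τ : V → ITerm S V} {t : Term S V} (h : ∀ x ∈ t.vars, σ x = τ x) :
    t.toITerm.subst σ = t.toITerm.subst τ :=
  ITerm.subst_congr h

theorem eq_of_subst_eq {σ τ : V → ITerm S V} {t : Term S V}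
    (h : t.toITerm.subst σ = t.toITerm.subst τ) : ∀ x ∈ t.vars, σ x = τ x := by
  induction t with
  | var y => simpa using h
  | app f ts ih =>
    intro x hx
    obtain ⟨i, hi⟩ := mem_vars_app.1 hx
    simp only [toITerm_app, subst_app, ITerm.app_inj] at h
    exact ih i (congrFun h i) x hi

theorem sym_rename (e : Equiv.Perm V) (t : Term S V) (p : List ℕ) (y : V) :
    (t.rename e).sym p = some (Sum.inr y) ↔ t.sym p = some (Sum.inr (e.symm y)) := by
  induction t generalizing p with
  | var x =>
    cases p with
    | nil => simp [rename, subst, sym, Equiv.eq_symm_apply]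
    | cons i p => simp [rename, subst, sym]
  | app f ts ih =>
    cases p with
    | nil => simp [rename, subst, sym]
    | cons i p =>
      by_cases h : i < S.arity f
      · simpa [rename, subst, sym, h] using ih ⟨i, h⟩ p
      · simp [rename, subst, sym, h]

theorem mem_vars_rename {e : Equiv.Perm V} {t : Term S V} {y : V} :
    y ∈ (t.rename e).vars ↔ e.symm y ∈ t.vars := by
  simp [vars, sym_rename]

theorem Linear.rename {t : Term S V} (h : t.Linear) (e : Equiv.Perm V) : (t.rename e).Linear :=
  fun x p q hp hq => h _ p q ((sym_rename e t p x).1 hp) ((sym_rename e t q x).1 hq)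

theorem subtermAt_induction {P : Term S V → List ℕ → Term S V → Prop}
    (nil : ∀ t, P t [] t)
    (cons : ∀ f ts (i : Fin (S.arity f)) p a, (ts i).subtermAt p = some a → P (ts i) p a →
      P (app f ts) (i.1 :: p) a) {t a : Term S V} {p : List ℕ} (h : t.subtermAt p = some a) :
    P t p a := by
  induction t generalizing p with
  | var x =>
    cases p with
    | nil =>
      obtain rfl : var x = a := by simpa [subtermAt] using h
      exact nil _
    | cons i p => simp [subtermAt] at h
  | app f ts ih =>
    cases p with
    | nil =>
      obtain rfl : app f ts = a := by simpa [subtermAt] using h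
      exact nil _
    | cons i p =>
      by_cases hi : i < S.arity f
      · have h' : (ts ⟨i, hi⟩).subtermAt p = some a := by simpa [subtermAt, hi] using h
        exact cons f ts ⟨i, hi⟩ p a h' (ih _ h')
      · simp [subtermAt, hi] at h

theorem vars_subset_of_subtermAt {t a : Term S V} {p : List ℕ} (h : t.subtermAt p = some a) :
    a.vars ⊆ t.vars := by
  refine subtermAt_induction (P := fun t _ a => a.vars ⊆ t.vars) (fun _ => subset_rfl) ?_ h
  intro f ts i p a _ ih x hx
  exact mem_vars_app.2 ⟨i, ih hx⟩

theorem Linear.subtermAt {t a : Term S V} {p : List ℕ} (ht : t.Linear)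
    (h : t.subtermAt p = some a) : a.Linear := by
  refine subtermAt_induction (P := fun t _ a => t.Linear → a.Linear) (fun _ => id) ?_ h ht
  intro f ts i p a _ ih h1
  exact ih (h1.arg i)

theorem isSubtermAt_subst {t a : Term S V} {p : List ℕ} (h : t.subtermAt p = some a)
    (σ : V → ITerm S V) : (t.toITerm.subst σ).IsSubtermAt p (a.toITerm.subst σ) := by
  refine subtermAt_induction
    (P := fun t p a => (t.toITerm.subst σ).IsSubtermAt p (a.toITerm.subst σ))
    (fun _ => isSubtermAt_nil.2 rfl) ?_ h
  intro f ts i p a _ ih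
  simpa [isSubtermAt_fin] using ih

theorem replaceAt_subst {t a : Term S V} {p : List ℕ} (h : t.subtermAt p = some a)
    (σ τ : V → ITerm S V) (v : ITerm S V) :
    ((t.toITerm.subst σ).replaceAt p v).subst τ =
      ((t.toITerm.subst σ).subst τ).replaceAt p (v.subst τ) := by
  refine subtermAt_induction (P := fun t p _ => ((t.toITerm.subst σ).replaceAt p v).subst τ =
      ((t.toITerm.subst σ).subst τ).replaceAt p (v.subst τ))
    (fun _ => by simp [replaceAt_nil]) ?_ h
  intro f ts i p a _ ih
  simp only [toITerm_app, subst_app, replaceAt_fin, ITerm.app_inj]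
  funext j
  rcases eq_or_ne j i with rfl | hj
  · simpa using ih
  · simp [Function.update_of_ne hj]

/-- Two linear terms without common variables that have a common instance by a substitution of
possibly infinite terms have a finite idempotent unifier, through which every unifier by possibly
infinite terms factors. Linearity and disjointness make the unifiers of the arguments of `a` and
`b` independent of each other, so that no occurs check is needed. -/
theorem exists_unifier {a b : Term S V} (ha : a.Linear) (hb : b.Linear)
    (hab : Disjoint a.vars b.vars) {η : V → ITerm S V}
    (h : a.toITerm.subst η = b.toITerm.subst η) :
    ∃ μ : V → Term S V, a.subst μ = b.subst μ ∧
      ∀ τ : V → ITerm S V, a.toITerm.subst τ = b.toITerm.subst τ →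
        ∀ x, τ x = (μ x).toITerm.subst τ := by
  classical
  -- A variable that does not occur in a term can be instantiated to that term.
  have key : ∀ (y : V) (t : Term S V), y ∉ t.vars →
      ∃ μ : V → Term S V, μ y = t.subst μ ∧
        ∀ τ : V → ITerm S V, τ y = t.toITerm.subst τ → ∀ x, τ x = (μ x).toITerm.subst τ := by
    intro y t hy
    refine ⟨Function.update Term.var y t, ?_, fun τ hτ x => ?_⟩
    · have : t.subst (Function.update Term.var y t) = t.subst Term.var := by
        refine subst_congr fun x hx => Function.update_of_ne ?_ _ _
        rintro rfl
        exact hy hx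
      rw [this, Function.update_self]
      clear * -
      induction t with
      | var x => rfl
      | app f ts ih =>
        simp only [subst]
        congr 1
        funext i
        exact ih i
    · rcases eq_or_ne x y with rfl | hx
      · simpa using hτ
      · simp [Function.update_of_ne hx]
  induction a generalizing b with
  | var y =>
    obtain ⟨μ, h1, h2⟩ := key y b fun hy => Set.disjoint_left.1 hab (by simp) hy
    exact ⟨μ, h1, fun τ hτ => h2 τ (by simpa using hτ)⟩
  | app f ts ih =>
    cases b with
    | var y =>
      obtain ⟨μ, h1, h2⟩ := key y (app f ts) fun hy => Set.disjoint_left.1 hab hy (by simp)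
      exact ⟨μ, h1.symm, fun τ hτ => h2 τ (by simpa using hτ.symm)⟩
    | app g us =>
      simp only [toITerm_app, subst_app] at h
      obtain rfl := symb_eq_of_app_eq h
      simp only [ITerm.app_inj] at h
      have hd : ∀ i j, Disjoint (ts i).vars (us j).vars := fun i j =>
        hab.mono (fun x hx => mem_vars_app.2 ⟨i, hx⟩) (fun x hx => mem_vars_app.2 ⟨j, hx⟩)
      choose μ h1 h2 using fun i => ih i (ha.arg i) (hb.arg i) (hd i i) (congrFun h i)
      let ν : V → Term S V := fun x =>
        if hx : ∃ i, x ∈ (ts i).vars ∪ (us i).vars then μ hx.choose x else Term.var x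
      have hν : ∀ i, ∀ x ∈ (ts i).vars ∪ (us i).vars, ν x = μ i x := by
        intro i x hx
        have hx' : ∃ i, x ∈ (ts i).vars ∪ (us i).vars := ⟨i, hx⟩
        have hi : hx'.choose = i := by
          rcases hx'.choose_spec with h3 | h3 <;> rcases hx with h4 | h4
          · exact ha.eq_of_mem_vars h3 h4
          · exact (Set.disjoint_left.1 (hd _ _) h3 h4).elim
          · exact (Set.disjoint_left.1 (hd _ _) h4 h3).elim
          · exact hb.eq_of_mem_vars h3 h4
        simp only [ν, hx', dite_true, hi]
      refine ⟨ν, ?_, fun τ hτ x => ?_⟩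
      · simp only [subst]
        congr 1
        funext i
        rw [subst_congr fun x hx => hν i x (Or.inl hx), h1 i,
          subst_congr fun x hx => (hν i x (Or.inr hx)).symm]
      · simp only [toITerm_app, subst_app, ITerm.app_inj] at hτ
        by_cases hx : ∃ i, x ∈ (ts i).vars ∪ (us i).vars
        · obtain ⟨i, hi⟩ := hx
          rw [hν i x hi]
          exact h2 i τ (congrFun hτ i) x
        · have hνx : ν x = Term.var x := dif_neg hx
          simp [hνx]

end Term

/-- A finite set of variables can be renamed away from another one. -/
theorem exists_perm_disjoint [Infinite V] {A B : Set V} (hA : A.Finite) (hB : B.Finite) :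
    ∃ e : Equiv.Perm V, ∀ x ∈ B, e x ∉ A := by
  classical
  induction B, hB using Set.Finite.induction_on with
  | empty => exact ⟨1, by simp⟩
  | @insert b B hb hB ih =>
    obtain ⟨e, he⟩ := ih
    obtain ⟨c, hc⟩ := (hA.union (hB.image e)).exists_notMem
    have hcA : c ∉ A := fun h => hc (Or.inl h)
    have hcB : c ∉ e '' B := fun h => hc (Or.inr h)
    refine ⟨e.trans (Equiv.swap (e b) c), fun x hx => ?_⟩
    rcases hx with rfl | hx
    · simpa using hcA
    · have h1 : e x ≠ e b := fun h => hb (e.injective h ▸ hx)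
      have h2 : e x ≠ c := fun h => hcB ⟨x, hx, h⟩
      simpa [Equiv.swap_apply_of_ne_of_ne h1 h2] using he x hx

/-- In a weakly orthogonal system, if the pattern of a redex of `ρ₁` at the root overlaps the
pattern of a redex of `ρ₂` at `p`, then contracting the one has the same effect as contracting the
other. The terms may be infinite; the critical pair behind the overlap is the one of finite
terms that `IsCriticalPair` speaks of. -/
theorem WeaklyOrthogonal.replaceAt_eq [Infinite V] (hR : WeaklyOrthogonal R) {ρ₁ ρ₂ : Rule S V}
    (h₁ : ρ₁ ∈ R) (h₂ : ρ₂ ∈ R) {p : List ℕ} {f : S.Symb} {ts : Fin (S.arity f) → Term S V}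
    (hp : ρ₁.lhs.subtermAt p = some (Term.app f ts)) {σ : V → ITerm S V} {v v' : ITerm S V}
    (hv : (ρ₁.lhs.toITerm.subst σ).IsSubtermAt p v) (hstep : RootStep ρ₂ v v') :
    (ρ₁.lhs.toITerm.subst σ).replaceAt p v' = ρ₁.rhs.subst σ := by
  classical
  obtain ⟨τ, rfl, rfl⟩ := hstep
  by_cases htriv : p = [] ∧ ρ₁ = ρ₂
  · obtain ⟨rfl, rfl⟩ := htriv
    rw [isSubtermAt_nil] at hv
    rw [replaceAt_nil]
    exact ITerm.subst_congr fun x hx => (Term.eq_of_subst_eq hv x (ρ₁.rhs_vars hx)).symm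
  obtain ⟨e, he⟩ := exists_perm_disjoint ρ₁.lhs.vars_finite ρ₂.lhs.vars_finite
  have hd : Disjoint ρ₁.lhs.vars (ρ₂.lhs.rename e).vars := by
    rw [Set.disjoint_left]
    intro x hx hx'
    exact he _ (Term.mem_vars_rename.1 hx') (by simpa using hx)
  -- A single substitution that is `σ` on the first rule and `τ` on the renamed second rule.
  let η : V → ITerm S V := fun x => if x ∈ ρ₁.lhs.vars then σ x else τ (e.symm x)
  have hησ : ∀ x ∈ ρ₁.lhs.vars, η x = σ x := fun x hx => if_pos hx
  have hητ : ∀ x ∈ ρ₂.lhs.vars, η (e x) = τ x := fun x hx => by simp [η, he x hx]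
  have hl₁ : ρ₁.lhs.toITerm.subst η = ρ₁.lhs.toITerm.subst σ := Term.toITerm_subst_congr hησ
  have hr₁ : ρ₁.rhs.subst η = ρ₁.rhs.subst σ :=
    ITerm.subst_congr fun x hx => hησ x (ρ₁.rhs_vars hx)
  have hl₂ : (ρ₂.lhs.rename e).toITerm.subst η = ρ₂.lhs.toITerm.subst τ := by
    rw [Term.rename, Term.toITerm_subst, subst_subst]
    refine Term.toITerm_subst_congr fun x hx => ?_
    simpa using hητ x hx
  have hr₂ : (ρ₂.rhs.rename e).subst η = ρ₂.rhs.subst τ := by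
    rw [ITerm.rename, subst_subst]
    refine ITerm.subst_congr fun x hx => ?_
    simpa using hητ x (ρ₂.rhs_vars hx)
  have hunif : (Term.app f ts).toITerm.subst η = (ρ₂.lhs.rename e).toITerm.subst η := by
    rw [hl₂]
    have := Term.isSubtermAt_subst hp η
    rw [hl₁] at this
    exact this.unique hv
  obtain ⟨μ, hμ, hmgu⟩ := Term.exists_unifier ((hR.1 ρ₁ h₁).subtermAt hp)
    ((hR.1 ρ₂ h₂).rename e) (hd.mono_left (Term.vars_subset_of_subtermAt hp)) hunif
  have hcp := hR.2 _ _ ⟨ρ₁, h₁, ρ₂, h₂, e, p, f, ts, μ, hd, htriv, hp, ⟨hμ, fun τ' hτ' =>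
    ⟨τ', fun x => Term.toITerm_injective ?_⟩⟩, rfl, rfl⟩
  · have hμη : ∀ t : ITerm S V, (t.subst fun x => (μ x).toITerm).subst η = t.subst η := by
      intro t
      rw [subst_subst]
      exact ITerm.subst_congr fun x _ => (hmgu η hunif x).symm
    have := congrArg (ITerm.subst η) hcp
    rwa [Term.toITerm_subst, Term.replaceAt_subst hp, hμη, hμη, hμη, hr₂, hl₁, hr₁] at this
  · rw [Term.toITerm_subst]
    refine hmgu (fun x => (τ' x).toITerm) ?_ x
    rw [← Term.toITerm_subst, ← Term.toITerm_subst, hτ']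

theorem Rule.lhs_eq_app (ρ : Rule S V) : ∃ f ts, ρ.lhs = Term.app f ts := by
  rcases h : ρ.lhs with x | ⟨f, ts⟩
  · exact (ρ.lhs_ne_var x h).elim
  · exact ⟨f, ts, rfl⟩

/-- Two steps at the root lead to the same term. -/
theorem WeaklyOrthogonal.rootStep_unique [Infinite V] (hR : WeaklyOrthogonal R) {ρ₁ ρ₂ : Rule S V}
    (h₁ : ρ₁ ∈ R) (h₂ : ρ₂ ∈ R) {s a b : ITerm S V} (ha : RootStep ρ₁ s a)
    (hb : RootStep ρ₂ s b) : a = b := by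
  obtain ⟨σ, rfl, rfl⟩ := ha
  obtain ⟨f, ts, hf⟩ := ρ₁.lhs_eq_app
  have := hR.replaceAt_eq h₁ h₂ (p := []) (σ := σ) (by rw [hf]; rfl) (isSubtermAt_nil.2 rfl) hb
  rw [← this, replaceAt_nil]

open Relation

/-! ### Relations below the root -/

/-- `Lift X s t`: the terms `s` and `t` have the same root symbol, and `X` relates their immediate
subterms. -/
inductive Lift (X : ITerm S V → ITerm S V → Prop) : ITerm S V → ITerm S V → Prop
  | var (x : V) : Lift X (ITerm.var x) (ITerm.var x)
  | app (f : S.Symb) {a b : Fin (S.arity f) → ITerm S V} (h : ∀ i, X (a i) (b i)) :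
      Lift X (ITerm.app f a) (ITerm.app f b)

/-- `X` relates the subterms at depth `d`, above which the terms are the same. -/
def LiftN (X : ITerm S V → ITerm S V → Prop) : ℕ → ITerm S V → ITerm S V → Prop
  | 0 => X
  | d + 1 => Lift (LiftN X d)

section Lift

variable {X Y : ITerm S V → ITerm S V → Prop}

theorem Lift.mono (h : ∀ a b, X a b → Y a b) {s t : ITerm S V} (hl : Lift X s t) : Lift Y s t := by
  cases hl with
  | var x => exact .var x
  | app f hi => exact .app f fun i => h _ _ (hi i)

theorem Lift.refl (h : ∀ a, X a a) (s : ITerm S V) : Lift X s s := by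
  rcases s.eq_var_or_app with ⟨x, rfl⟩ | ⟨f, a, rfl⟩
  · exact .var x
  · exact .app f fun i => h _

theorem Lift.swap {s t : ITerm S V} (h : Lift X s t) : Lift (fun a b => X b a) t s := by
  cases h with
  | var x => exact .var x
  | app f hi => exact .app f hi

theorem lift_app_left {f : S.Symb} {a : Fin (S.arity f) → ITerm S V} {t : ITerm S V} :
    Lift X (ITerm.app f a) t ↔ ∃ b, t = ITerm.app f b ∧ ∀ i, X (a i) (b i) := by
  constructor
  · intro h
    generalize hs : ITerm.app f a = s at h
    cases h with
    | var x => simp at hs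
    | app g hi =>
      obtain rfl := symb_eq_of_app_eq hs
      obtain rfl := ITerm.app_inj.1 hs
      exact ⟨_, rfl, hi⟩
  · rintro ⟨b, rfl, h⟩
    exact .app f h

theorem lift_app {f : S.Symb} {a b : Fin (S.arity f) → ITerm S V} :
    Lift X (ITerm.app f a) (ITerm.app f b) ↔ ∀ i, X (a i) (b i) := by
  simp [lift_app_left]

theorem lift_app_right {f : S.Symb} {b : Fin (S.arity f) → ITerm S V} {t : ITerm S V} :
    Lift X t (ITerm.app f b) ↔ ∃ a, t = ITerm.app f a ∧ ∀ i, X (a i) (b i) :=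
  ⟨fun h => lift_app_left.1 h.swap, by rintro ⟨a, rfl, h⟩; exact .app f h⟩

theorem Lift.comp {Z : ITerm S V → ITerm S V → Prop} (h : ∀ a b c, X a b → Y b c → Z a c)
    {r s t : ITerm S V} (h1 : Lift X r s) (h2 : Lift Y s t) : Lift Z r t := by
  cases h1 with
  | var x =>
    generalize hs : ITerm.var x = s at h2
    cases h2 with
    | var y => exact .var y
    | app f hi => simp at hs
  | app f hi =>
    obtain ⟨c, rfl, hc⟩ := lift_app_left.1 h2
    exact .app f fun i => h _ _ _ (hi i) (hc i)

theorem LiftN.swap {d : ℕ} {s t : ITerm S V} (h : LiftN X d s t) :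
    LiftN (fun a b => X b a) d t s := by
  induction d generalizing s t with
  | zero => exact h
  | succ d ih => exact (Lift.swap h).mono fun _ _ h => ih h

theorem LiftN.fold (hX : ∀ a b, Lift X a b → X a b) {d : ℕ} {s t : ITerm S V}
    (h : LiftN X d s t) : X s t := by
  induction d generalizing s t with
  | zero => exact h
  | succ d ih => exact hX _ _ (Lift.mono (fun _ _ h => ih h) h)

theorem LiftN.agreeBelow {d : ℕ} {s t : ITerm S V} (h : LiftN X d s t) : AgreeBelow d s t := by
  induction d generalizing s t with
  | zero => intro q hq; simp at hq
  | succ d ih =>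
    cases (h : Lift (LiftN X d) s t) with
    | var x => exact fun _ _ => rfl
    | app f hi => exact agreeBelow_app.2 fun i => ih (hi i)

end Lift

/-! ### Finite reductions and infinitary reduction, coinductively -/

/-- A rewrite step at a position of depth at least `d`. -/
def StepGE (R : ITRS S V) (d : ℕ) (s t : ITerm S V) : Prop :=
  ∃ p : List ℕ, d ≤ p.length ∧ StepAt R p s t

theorem StepGE.mono {d e : ℕ} (hd : d ≤ e) {s t : ITerm S V} (h : StepGE R e s t) :
    StepGE R d s t :=
  let ⟨p, hp, h⟩ := h
  ⟨p, hd.trans hp, h⟩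

theorem StepGE.app {d : ℕ} {f : S.Symb} {a : Fin (S.arity f) → ITerm S V} {i : Fin (S.arity f)}
    {b : ITerm S V} (h : StepGE R d (a i) b) :
    StepGE R (d + 1) (ITerm.app f a) (ITerm.app f (Function.update a i b)) :=
  let ⟨p, hp, h⟩ := h
  ⟨i.1 :: p, by simpa using hp, stepAt_cons.2 ⟨f, a, i, b, rfl, h, rfl, rfl⟩⟩

/-- A step below the root is a step in one of the immediate subterms. -/
theorem StepGE.eq_app {d : ℕ} {s t : ITerm S V} (h : StepGE R (d + 1) s t) :
    ∃ (f : S.Symb) (a : Fin (S.arity f) → ITerm S V) (i : Fin (S.arity f)) (b : ITerm S V),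
      StepGE R d (a i) b ∧ s = ITerm.app f a ∧ t = ITerm.app f (Function.update a i b) := by
  obtain ⟨_ | ⟨i, p⟩, hp, h⟩ := h
  · simp at hp
  · obtain ⟨f, a, j, b, rfl, h1, rfl, rfl⟩ := stepAt_cons.1 h
    exact ⟨f, a, j, b, ⟨p, by simpa using hp, h1⟩, rfl, rfl⟩

/-- Reductions of the immediate subterms, of which there are finitely many, can be performed one
after the other. -/
theorem reflTransGen_stepGE_app {d : ℕ} {f : S.Symb} {a b : Fin (S.arity f) → ITerm S V}
    (h : ∀ i, ReflTransGen (StepGE R d) (a i) (b i)) :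
    ReflTransGen (StepGE R (d + 1)) (ITerm.app f a) (ITerm.app f b) := by
  classical
  have one : ∀ (g : Fin (S.arity f) → ITerm S V) (i : Fin (S.arity f)) (c : ITerm S V),
      ReflTransGen (StepGE R d) (g i) c →
        ReflTransGen (StepGE R (d + 1)) (ITerm.app f g) (ITerm.app f (Function.update g i c)) := by
    intro g i c hc
    induction hc with
    | refl => simpa using ReflTransGen.refl
    | @tail c c' _ hcc' ih =>
      refine ih.tail ?_
      have := StepGE.app (a := Function.update g i c) (i := i) (b := c') (by simpa using hcc')
      simpa using this
  have all : ∀ s : Finset (Fin (S.arity f)),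
      ReflTransGen (StepGE R (d + 1)) (ITerm.app f a) (ITerm.app f (s.piecewise b a)) := by
    intro s
    induction s using Finset.induction_on with
    | empty => simpa using ReflTransGen.refl
    | insert i s hi ih =>
      rw [Finset.piecewise_insert]
      exact ih.trans (one _ i _ (by simpa [hi] using h i))
  simpa using all Finset.univ

/-- Infinitary reduction, as a greatest fixed point: `s` has a finite reduction to a term with the
root symbol of `t`, whose immediate subterms reduce to those of `t` in the same sense. -/
def Red (R : ITRS S V) (s t : ITerm S V) : Prop :=
  ∃ X : ITerm S V → ITerm S V → Prop,
    (∀ a b, X a b → ∃ a', ReflTransGen (StepGE R 0) a a' ∧ Lift X a' b) ∧ X s t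

namespace Red

theorem unfold {s t : ITerm S V} (h : Red R s t) :
    ∃ s', ReflTransGen (StepGE R 0) s s' ∧ Lift (Red R) s' t := by
  obtain ⟨X, hX, h⟩ := h
  obtain ⟨s', h1, h2⟩ := hX _ _ h
  exact ⟨s', h1, h2.mono fun a b hab => ⟨X, hX, hab⟩⟩

theorem coind (X : ITerm S V → ITerm S V → Prop)
    (hX : ∀ a b, X a b → ∃ a', ReflTransGen (StepGE R 0) a a' ∧
      Lift (fun c d => X c d ∨ Red R c d) a' b) {s t : ITerm S V} (h : X s t) : Red R s t := by
  refine ⟨fun a b => X a b ∨ Red R a b, ?_, Or.inl h⟩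
  rintro a b (h | h)
  · exact hX a b h
  · obtain ⟨a', h1, h2⟩ := h.unfold
    exact ⟨a', h1, h2.mono fun _ _ => Or.inr⟩

theorem refl (s : ITerm S V) : Red R s s :=
  coind (fun a b => a = b) (fun a _ h => ⟨a, .refl, h ▸ Lift.refl (fun _ => Or.inl rfl) a⟩) rfl

theorem of_lift {s t : ITerm S V} (h : Lift (Red R) s t) : Red R s t :=
  coind (fun a b => Lift (Red R) a b) (fun a _ h => ⟨a, .refl, h.mono fun _ _ => Or.inr⟩) h

theorem head {r s t : ITerm S V} (h : ReflTransGen (StepGE R 0) r s) (h' : Red R s t) :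
    Red R r t := by
  refine coind (fun a b => ∃ c, ReflTransGen (StepGE R 0) a c ∧ Red R c b) ?_ ⟨s, h, h'⟩
  rintro a b ⟨c, h1, h2⟩
  obtain ⟨c', h3, h4⟩ := h2.unfold
  exact ⟨c', h1.trans h3, h4.mono fun _ _ => Or.inr⟩

theorem subst {σ τ : V → ITerm S V} (h : ∀ x, Red R (σ x) (τ x)) (t : ITerm S V) :
    Red R (t.subst σ) (t.subst τ) := by
  refine coind (fun a b => ∃ t : ITerm S V, a = t.subst σ ∧ b = t.subst τ) ?_ ⟨t, rfl, rfl⟩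
  rintro _ _ ⟨t, rfl, rfl⟩
  rcases t.eq_var_or_app with ⟨x, rfl⟩ | ⟨f, a, rfl⟩
  · obtain ⟨a', h1, h2⟩ := (h x).unfold
    exact ⟨a', by simpa using h1, by simpa using h2.mono fun _ _ => Or.inr⟩
  · exact ⟨_, .refl, by simpa [lift_app] using fun i => Or.inl ⟨a i, rfl, rfl⟩⟩

end Red

/-- One more level of the limit can be reached by finitely many steps at depth `d` or more. -/
theorem LiftN.unfold {d : ℕ} {s t : ITerm S V} (h : LiftN (Red R) d s t) :
    ∃ s', ReflTransGen (StepGE R d) s s' ∧ LiftN (Red R) (d + 1) s' t := by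
  induction d generalizing s t with
  | zero => exact Red.unfold h
  | succ d ih =>
    cases (h : Lift (LiftN (Red R) d) s t) with
    | var x => exact ⟨_, .refl, .var x⟩
    | @app f a b hi =>
      choose c h1 h2 using fun i => ih (hi i)
      exact ⟨ITerm.app f c, reflTransGen_stepGE_app h1, .app f h2⟩

theorem LiftN.unfold_add {d : ℕ} {s t : ITerm S V} (h : LiftN (Red R) d s t) (n : ℕ) :
    ∃ s', ReflTransGen (StepGE R d) s s' ∧ LiftN (Red R) (d + n) s' t := by
  induction n with
  | zero => exact ⟨s, .refl, h⟩
  | succ n ih =>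
    obtain ⟨s', h1, h2⟩ := ih
    obtain ⟨s'', h3, h4⟩ := h2.unfold
    exact ⟨s'', h1.trans (ReflTransGen.mono (fun _ _ => StepGE.mono (Nat.le_add_right d n)) _ _ h3), h4⟩

/-- The depth of a finite term: the largest number of function symbols on a path. Constants count, so
that every position of a function symbol has smaller length. -/
def Term.depth : Term S V → ℕ
  | .var _ => 0
  | .app _ ts => (Finset.univ.sup fun i => (ts i).depth) + 1

/-- Substitutions, one for each argument of a linear term, can be glued. -/
theorem Term.Linear.exists_glue {f : S.Symb} {ts : Fin (S.arity f) → Term S V}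
    (h : (Term.app f ts).Linear) (σ : Fin (S.arity f) → V → ITerm S V) (τ : V → ITerm S V) :
    ∃ ν : V → ITerm S V, (∀ i, ∀ x ∈ (ts i).vars, ν x = σ i x) ∧
      ∀ x, ν x = τ x ∨ ∃ i, ν x = σ i x := by
  classical
  refine ⟨fun x => if hx : ∃ i, x ∈ (ts i).vars then σ hx.choose x else τ x, ?_, ?_⟩
  · intro i x hx
    have hx' : ∃ i, x ∈ (ts i).vars := ⟨i, hx⟩
    simp only [hx', dite_true, h.eq_of_mem_vars hx'.choose_spec hx]
  · intro x
    by_cases hx : ∃ i, x ∈ (ts i).vars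
    · exact Or.inr ⟨hx.choose, by simp [hx]⟩
    · exact Or.inl (by simp [hx])

/-- A term that differs from an instance of a linear pattern only below the pattern is an instance
of that pattern. -/
theorem Term.Linear.exists_subst_of_liftN {X : ITerm S V → ITerm S V → Prop} (hX : ∀ a, X a a)
    (hX' : ∀ a b, Lift X a b → X a b) {l : Term S V} (hl : l.Linear) {d : ℕ} (hd : l.depth ≤ d)
    {σ : V → ITerm S V} {t : ITerm S V} (h : LiftN X d (l.toITerm.subst σ) t) :
    ∃ τ : V → ITerm S V, t = l.toITerm.subst τ ∧ ∀ x, X (σ x) (τ x) := by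
  classical
  induction l generalizing d t with
  | var y =>
    refine ⟨Function.update σ y t, by simp, fun x => ?_⟩
    rcases eq_or_ne x y with rfl | hx
    · simpa using h.fold hX'
    · simpa [hx] using hX _
  | app f ts ih =>
    obtain ⟨d, rfl⟩ : ∃ e, d = e + 1 := ⟨d - 1, by simp only [depth] at hd; omega⟩
    simp only [toITerm_app, subst_app] at h
    obtain ⟨b, rfl, hb⟩ := lift_app_left.1 h
    have hd' : ∀ i, (ts i).depth ≤ d := fun i =>
      (Finset.le_sup (f := fun i => (ts i).depth) (Finset.mem_univ i)).trans
        (by simpa [depth] using hd)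
    choose τ h1 h2 using fun i => ih i (hl.arg i) (hd' i) (hb i)
    obtain ⟨ν, h3, h4⟩ := hl.exists_glue τ σ
    refine ⟨ν, ?_, fun x => ?_⟩
    · simp only [toITerm_app, subst_app, ITerm.app_inj]
      funext i
      rw [h1 i, toITerm_subst_congr (h3 i)]
    · rcases h4 x with h5 | ⟨i, h5⟩
      · exact h5 ▸ hX _
      · exact h5 ▸ h2 i x

namespace Red

/-- A step can be appended to an infinitary reduction: the redex pattern, being finite, is there
after a finite part of the reduction. -/
theorem tail (hR : ∀ ρ ∈ R, ρ.lhs.Linear) {s t u : ITerm S V} (h : Red R s t)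
    (h' : StepGE R 0 t u) : Red R s u := by
  obtain ⟨p, -, hp⟩ := h'
  induction p generalizing s t u with
  | nil =>
    obtain ⟨ρ, hρ, σ, rfl, rfl⟩ := stepAt_nil.1 hp
    obtain ⟨s', h1, h2⟩ := LiftN.unfold_add (d := 0) h ρ.lhs.depth
    obtain ⟨τ, rfl, h3⟩ := (hR ρ hρ).exists_subst_of_liftN (X := fun a b => Red R b a) Red.refl
      (fun _ _ hab => of_lift hab.swap) (Nat.le_add_left _ 0) h2.swap
    exact head (h1.tail ⟨[], le_rfl, stepAt_nil.2 ⟨ρ, hρ, τ, rfl, rfl⟩⟩) (subst h3 _)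
  | cons i p ih =>
    obtain ⟨f, a, j, b, rfl, h1, rfl, rfl⟩ := stepAt_cons.1 hp
    obtain ⟨s', h2, h3⟩ := h.unfold
    obtain ⟨c, rfl, hc⟩ := lift_app_right.1 h3
    refine head h2 (of_lift (.app f fun k => ?_))
    rcases eq_or_ne k j with rfl | hk
    · simpa using ih (hc k) h1
    · simpa [hk] using hc k

theorem trans (hR : ∀ ρ ∈ R, ρ.lhs.Linear) {r s t : ITerm S V} (h : Red R r s)
    (h' : Red R s t) : Red R r t := by
  refine coind (fun a b => ∃ c, Red R a c ∧ Red R c b) ?_ ⟨s, h, h'⟩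
  rintro a b ⟨c, h1, h2⟩
  obtain ⟨c', h3, h4⟩ := h2.unfold
  have h5 : Red R a c' := by
    clear h4
    induction h3 with
    | refl => exact h1
    | tail _ h6 ih => exact ih.tail hR h6
  obtain ⟨a', h6, h7⟩ := h5.unfold
  exact ⟨a', h6, h7.comp (fun x y z hxy hyz => Or.inl ⟨y, hxy, hyz⟩) h4⟩

/-- Coinduction in which the first terms may be left by infinitary reductions. -/
theorem coind_trans (hR : ∀ ρ ∈ R, ρ.lhs.Linear) (X : ITerm S V → ITerm S V → Prop)
    (hX : ∀ a b, X a b → ∃ a', Red R a a' ∧ Lift (fun c d => X c d ∨ Red R c d) a' b)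
    {s t : ITerm S V} (h : X s t) : Red R s t := by
  refine coind (fun a b => ∃ c, Red R a c ∧ X c b) ?_ ⟨s, refl s, h⟩
  rintro a b ⟨c, h1, h2⟩
  obtain ⟨c', h3, h4⟩ := hX c b h2
  obtain ⟨a', h5, h6⟩ := (h1.trans hR h3).unfold
  refine ⟨a', h5, h6.comp ?_ h4⟩
  rintro x y z hxy (hyz | hyz)
  · exact Or.inl ⟨y, hxy, hyz⟩
  · exact Or.inr (hxy.trans hR hyz)

end Red

/-! ### Strongly convergent sequences and coinductive reduction -/

/-- The terms `x γ`, `β ≤ γ ≤ l`, form a strongly convergent sequence in which some steps may be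
empty. Unlike the sequences without empty steps, these restrict to sequences of subterms. -/
structure IsWeakSeq (R : ITRS S V) (x : Ordinal.{0} → ITerm S V) (β l : Ordinal.{0}) : Prop where
  step : ∀ γ, β ≤ γ → γ < l → ReflGen (StepGE R 0) (x γ) (x (γ + 1))
  limit : ∀ m, β < m → m ≤ l → Order.IsSuccLimit m → ∀ d : ℕ, ∃ δ, β ≤ δ ∧ δ < m ∧
    ∀ γ, δ ≤ γ → γ < m → ReflGen (StepGE R d) (x γ) (x (γ + 1)) ∧ (x γ).AgreeBelow d (x m)

theorem IsWeakSeq.mono {x : Ordinal.{0} → ITerm S V} {β β' l l' : Ordinal.{0}}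
    (h : IsWeakSeq R x β l) (hβ : β ≤ β') (hl : l' ≤ l) : IsWeakSeq R x β' l' where
  step γ h1 h2 := h.step γ (hβ.trans h1) (h2.trans_le hl)
  limit m h1 h2 hm d := by
    obtain ⟨δ, _, h4, h5⟩ := h.limit m (hβ.trans_lt h1) (h2.trans hl) hm d
    exact ⟨max δ β', le_max_right _ _, max_lt h4 h1,
      fun γ h6 => h5 γ ((le_max_left _ _).trans h6)⟩

theorem reflGen_stepGE_app {d : ℕ} {f : S.Symb} {a b : Fin (S.arity f) → ITerm S V}
    (h : ReflGen (StepGE R (d + 1)) (ITerm.app f a) (ITerm.app f b)) (i : Fin (S.arity f)) :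
    ReflGen (StepGE R d) (a i) (b i) := by
  generalize hs : ITerm.app f a = s at h
  generalize ht : ITerm.app f b = t at h
  cases h with
  | refl =>
    rw [ITerm.app_inj.1 (hs.trans ht.symm)]
  | single h =>
    obtain ⟨g, a', j, c, h1, rfl, rfl⟩ := h.eq_app
    obtain rfl := symb_eq_of_app_eq hs
    obtain rfl := ITerm.app_inj.1 hs
    obtain rfl := ITerm.app_inj.1 ht
    rcases eq_or_ne i j with rfl | hij
    · simpa using ReflGen.single h1
    · simpa [hij] using ReflGen.refl

/-- Compression: a strongly convergent sequence of any ordinal length gives a reduction in the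
coinductive sense. -/
theorem IsWeakSeq.red (hR : ∀ ρ ∈ R, ρ.lhs.Linear) {x : Ordinal.{0} → ITerm S V}
    {β l : Ordinal.{0}} (hβ : β ≤ l) (h : IsWeakSeq R x β l) : Red R (x β) (x l) := by
  induction l using WellFoundedLT.induction generalizing x β with
  | ind l ih =>
  rcases hβ.eq_or_lt with rfl | hβ
  · exact Red.refl _
  rcases Ordinal.zero_or_succ_or_isSuccLimit l with rfl | ⟨m, rfl⟩ | hl
  · exact (not_lt_zero hβ).elim
  · rw [Order.succ_eq_add_one] at *
    have hm : m < m + 1 := Order.lt_succ m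
    have hβm : β ≤ m := Order.lt_succ_iff.1 hβ
    have h1 := ih m hm hβm (h.mono le_rfl hm.le)
    have h2 := h.step m hβm hm
    generalize x (m + 1) = t at h2
    cases h2 with
    | refl => exact h1
    | single h2 => exact h1.tail hR h2
  · refine Red.coind_trans hR (fun a b => ∃ (x : Ordinal.{0} → ITerm S V) (β : Ordinal.{0}),
      β < l ∧ IsWeakSeq R x β l ∧ a = x β ∧ b = x l) ?_ ⟨x, β, hβ, h, rfl, rfl⟩
    clear! x β
    rintro _ _ ⟨x, β, hβ, h, rfl, rfl⟩
    obtain ⟨δ, h1, h2, h3⟩ := h.limit l hβ le_rfl hl 1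
    refine ⟨x δ, ih δ h2 h1 (h.mono le_rfl h2.le), ?_⟩
    have hroot : ∀ γ, δ ≤ γ → γ ≤ l → (x γ).sym [] = (x l).sym [] := by
      intro γ h4 h5
      rcases h5.eq_or_lt with rfl | h5
      · rfl
      · exact (h3 γ h4 h5).2 [] (by simp)
    rcases (x l).eq_var_or_app with ⟨y, hy⟩ | ⟨f, b, hb⟩
    · have h4 : x δ = ITerm.var y := eq_var_of_sym_nil (by rw [hroot δ le_rfl h2.le, hy]; rfl)
      rw [h4, hy]
      exact .var y
    · have happ : ∀ γ, δ ≤ γ → γ ≤ l → x γ = ITerm.app f fun i => (x γ).arg i.1 :=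
        fun γ h4 h5 => eq_app_of_sym_nil (by rw [hroot γ h4 h5, hb]; rfl)
      rw [happ δ le_rfl h2.le, happ l h2.le le_rfl]
      refine .app f fun i => Or.inl ⟨fun γ => (x γ).arg i.1, δ, h2, ⟨?_, ?_⟩, rfl, rfl⟩
      · intro γ h4 h5
        have h6 := (h3 γ h4 h5).1
        rw [happ γ h4 h5.le, happ (γ + 1) (h4.trans (Order.le_succ γ)) (Order.succ_le_of_lt h5)]
          at h6
        exact reflGen_stepGE_app h6 i
      · intro m h4 h5 hm d
        obtain ⟨ε, h6, h7, h8⟩ := (h.mono h1 le_rfl).limit m h4 h5 hm (d + 1)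
        refine ⟨ε, h6, h7, fun γ h9 h10 => ?_⟩
        have h11 := h8 γ h9 h10
        have h12 : δ ≤ γ := h6.trans h9
        have h13 : γ < l := h10.trans_le h5
        rw [happ γ h12 h13.le, happ m h4.le h5,
          happ (γ + 1) (h12.trans (Order.le_succ γ)) (Order.succ_le_of_lt h13)] at h11
        exact ⟨reflGen_stepGE_app h11.1 i, agreeBelow_app.1 h11.2 i⟩

theorem InfReduces.red (hR : ∀ ρ ∈ R, ρ.lhs.Linear) {s t : ITerm S V} (h : InfReduces R s t) :
    Red R s t := by
  obtain ⟨α, x, p, hx, rfl, rfl⟩ := h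
  refine IsWeakSeq.red hR zero_le ⟨fun γ _ h => .single ⟨p γ, zero_le, hx.step γ h⟩,
    fun m _ h hm d => ?_⟩
  obtain ⟨β, h1, h2⟩ := hx.limit m h hm d
  exact ⟨β, zero_le, h1, fun γ h3 h4 =>
    ⟨.single ⟨p γ, (h2 γ h3 h4).1, hx.step γ (h4.trans_le h)⟩, (h2 γ h3 h4).2⟩⟩

/-- The ordinal-indexed sequence that extends `x` beyond the finite ordinals by the term `t`. -/
noncomputable def ordinalSeq {A : Type*} (x : ℕ → A) (t : A) (β : Ordinal.{0}) : A :=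
  open Classical in if β < Ordinal.omega0 then x (Cardinal.toNat β.card) else t

theorem ordinalSeq_natCast {A : Type*} (x : ℕ → A) (t : A) (n : ℕ) : ordinalSeq x t n = x n := by
  simp [ordinalSeq, Ordinal.natCast_lt_omega0]

theorem ordinalSeq_natCast_add_one {A : Type*} (x : ℕ → A) (t : A) (n : ℕ) :
    ordinalSeq x t ((n : Ordinal.{0}) + 1) = x (n + 1) := by
  rw [← ordinalSeq_natCast x t (n + 1), Nat.cast_add_one]

theorem InfReduces.of_finite {x : ℕ → ITerm S V} {p : ℕ → List ℕ} {N : ℕ}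
    (h : ∀ n < N, StepAt R (p n) (x n) (x (n + 1))) : InfReduces R (x 0) (x N) := by
  refine ⟨N, ordinalSeq x (x 0), ordinalSeq p [], ⟨fun β hβ => ?_, fun l hl hlim => ?_⟩, ?_, ?_⟩
  · obtain ⟨n, rfl⟩ := Ordinal.lt_omega0.1 (hβ.trans (Ordinal.natCast_lt_omega0 N))
    rw [ordinalSeq_natCast, ordinalSeq_natCast, ordinalSeq_natCast_add_one]
    exact h n (by exact_mod_cast hβ)
  · exact absurd ((Ordinal.omega0_le_of_isSuccLimit hlim).trans hl)
      (not_le.2 (Ordinal.natCast_lt_omega0 N))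
  · simpa using ordinalSeq_natCast x (x 0) 0
  · exact ordinalSeq_natCast x (x 0) N

theorem InfReduces.of_omega {x : ℕ → ITerm S V} {p : ℕ → List ℕ} {t : ITerm S V}
    (h : ∀ n, StepAt R (p n) (x n) (x (n + 1)))
    (hlim : ∀ d, ∃ N, ∀ n ≥ N, d ≤ (p n).length ∧ (x n).AgreeBelow d t) :
    InfReduces R (x 0) t := by
  have htop : ordinalSeq x t Ordinal.omega0 = t := by simp [ordinalSeq]
  refine ⟨Ordinal.omega0, ordinalSeq x t, ordinalSeq p [],
    ⟨fun β hβ => ?_, fun l hl hl' d => ?_⟩, ?_, htop⟩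
  · obtain ⟨n, rfl⟩ := Ordinal.lt_omega0.1 hβ
    rw [ordinalSeq_natCast, ordinalSeq_natCast, ordinalSeq_natCast_add_one]
    exact h n
  · obtain rfl := hl.antisymm (Ordinal.omega0_le_of_isSuccLimit hl')
    obtain ⟨N, hN⟩ := hlim d
    refine ⟨N, Ordinal.natCast_lt_omega0 N, fun γ h1 h2 => ?_⟩
    obtain ⟨n, rfl⟩ := Ordinal.lt_omega0.1 h2
    rw [ordinalSeq_natCast, ordinalSeq_natCast, htop]
    exact hN n (by exact_mod_cast h1)
  · simpa using ordinalSeq_natCast x t 0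

/-- From the given term one gets, by exactly the given number of steps at depth `k` or more, to a
term that agrees with the limit `t` up to depth `k` and reduces to it below. -/
def ReachIn (R : ITRS S V) (k : ℕ) (t : ITerm S V) : ℕ → ITerm S V → Prop
  | 0, s => LiftN (Red R) (k + 1) s t
  | n + 1, s => ∃ p s', k ≤ p.length ∧ StepAt R p s s' ∧ ReachIn R k t n s'

theorem LiftN.exists_reachIn {k : ℕ} {s t : ITerm S V} (h : LiftN (Red R) k s t) :
    ∃ n, ReachIn R k t n s := by
  obtain ⟨s', h1, h2⟩ := h.unfold
  clear h
  induction h1 using ReflTransGen.head_induction_on with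
  | refl => exact ⟨0, h2⟩
  | head h3 _ ih =>
    obtain ⟨n, hn⟩ := ih
    obtain ⟨p, hp, h4⟩ := h3
    exact ⟨n + 1, p, _, hp, h4, hn⟩

theorem ReachIn.agreeBelow {k n : ℕ} {s t : ITerm S V} (h : ReachIn R k t n s) :
    AgreeBelow k s t := by
  induction n generalizing s with
  | zero => exact (LiftN.agreeBelow h).mono k.le_succ
  | succ n ih =>
    obtain ⟨p, s', h1, h2, h3⟩ := h
    exact (h2.agreeBelow.mono h1).trans (ih h3)

/-- Before the limit is reached, there is a next step. It makes progress: it raises the depth `k`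
or, if `k` stays the same, lowers the number `n` of steps to go. -/
theorem ReachIn.exists_step {k n : ℕ} {s t : ITerm S V} (h : ReachIn R k t n s) (hst : s ≠ t) :
    ∃ k' n' s' p, StepAt R p s s' ∧ k ≤ p.length ∧ ReachIn R k' t n' s' ∧
      (k < k' ∨ k = k' ∧ n' < n) := by
  cases n with
  | succ n =>
    obtain ⟨p, s', h1, h2, h3⟩ := h
    exact ⟨k, n, s', p, h2, h1, h3, Or.inr ⟨rfl, n.lt_succ_self⟩⟩
  | zero =>
    -- Raise the depth for as long as that takes no steps.
    have h1 : ∃ m, ¬ LiftN (Red R) (k + 1 + m) s t := by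
      by_contra! h1
      exact hst (eq_of_agreeBelow fun d => (h1 d).agreeBelow.mono (by omega))
    classical
    have h2 := Nat.find_spec h1
    have h3 : ∃ m, Nat.find h1 = m + 1 := by
      refine Nat.exists_eq_succ_of_ne_zero fun h0 => ?_
      rw [h0] at h2
      exact h2 h
    obtain ⟨m, hm⟩ := h3
    have h4 : LiftN (Red R) (k + 1 + m) s t := by
      have := Nat.find_min h1 (m := m) (by omega)
      exact not_not.1 this
    rw [hm] at h2
    obtain ⟨n, hn⟩ := h4.exists_reachIn
    cases n with
    | zero => exact (h2 hn).elim
    | succ n =>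
      obtain ⟨p, s', h5, h6, h7⟩ := hn
      exact ⟨k + 1 + m, n, s', p, h6, by omega, h7, Or.inl (by omega)⟩

theorem Red.infReduces {s t : ITerm S V} (h : Red R s t) : InfReduces R s t := by
  classical
  let Q := {y : ℕ × ℕ × ITerm S V // ReachIn R y.1 t y.2.1 y.2.2}
  have hnext : ∀ y : Q, ∃ (z : Q) (p : List ℕ), y.1.2.2 ≠ t →
      StepAt R p y.1.2.2 z.1.2.2 ∧ y.1.1 ≤ p.length ∧
        (y.1.1 < z.1.1 ∨ y.1.1 = z.1.1 ∧ z.1.2.1 < y.1.2.1) := by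
    intro y
    by_cases hy : y.1.2.2 = t
    · exact ⟨y, [], fun h => (h hy).elim⟩
    · obtain ⟨k', n', s', p, h1, h2, h3, h4⟩ := y.2.exists_step hy
      exact ⟨⟨(k', n', s'), h3⟩, p, fun _ => ⟨h1, h2, h4⟩⟩
  choose next p hp using hnext
  obtain ⟨n₀, hn₀⟩ := LiftN.exists_reachIn (k := 0) h
  let y : ℕ → Q := fun n => next^[n] ⟨(0, n₀, s), hn₀⟩
  have hy : ∀ n, y (n + 1) = next (y n) := fun n => Function.iterate_succ_apply' _ _ _
  let x : ℕ → ITerm S V := fun n => (y n).1.2.2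
  by_cases hfin : ∃ N, x N = t
  · have h1 : InfReduces R (x 0) (x (Nat.find hfin)) := by
      refine InfReduces.of_finite (p := fun n => p (y n)) fun n hn => ?_
      have := (hp (y n) (Nat.find_min hfin hn)).1
      rwa [← hy] at this
    rwa [Nat.find_spec hfin] at h1
  · have hne : ∀ n, x n ≠ t := fun n hn => hfin ⟨n, hn⟩
    have hstep : ∀ n, StepAt R (p (y n)) (x n) (x (n + 1)) ∧ (y n).1.1 ≤ (p (y n)).length ∧
        ((y n).1.1 < (y (n + 1)).1.1 ∨
          (y n).1.1 = (y (n + 1)).1.1 ∧ (y (n + 1)).1.2.1 < (y n).1.2.1) := by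
      intro n
      rw [hy n]
      have h1 := hp (y n) (hne n)
      rw [← hy] at h1
      simpa [x, hy] using h1
    have hmono : Monotone fun n => (y n).1.1 := by
      refine monotone_nat_of_le_succ fun n => ?_
      rcases (hstep n).2.2 with h1 | h1
      · exact h1.le
      · exact h1.1.le
    have hunbounded : ∀ d, ∃ N, d ≤ (y N).1.1 := by
      intro d
      induction d with
      | zero => exact ⟨0, Nat.zero_le _⟩
      | succ d ih =>
        obtain ⟨N, hN⟩ := ih
        have key : ∀ m N, d ≤ (y N).1.1 → (y N).1.2.1 ≤ m → ∃ N, d + 1 ≤ (y N).1.1 := by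
          intro m
          induction m with
          | zero =>
            intro N h1 h2
            refine ⟨N + 1, ?_⟩
            rcases (hstep N).2.2 with h3 | h3 <;> omega
          | succ m ih =>
            intro N h1 h2
            rcases (hstep N).2.2 with h3 | h3
            · exact ⟨N + 1, by omega⟩
            · exact ih (N + 1) (by omega) (by omega)
        exact key _ N hN le_rfl
    refine InfReduces.of_omega (x := x) (p := fun n => p (y n)) (fun n => (hstep n).1) fun d => ?_
    obtain ⟨N, hN⟩ := hunbounded d
    refine ⟨N, fun n hn => ?_⟩
    have h1 : d ≤ (y n).1.1 := hN.trans (hmono hn)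
    exact ⟨h1.trans (hstep n).2.1, (y n).2.agreeBelow.mono h1⟩

/-! ### Parallel steps -/

/-- Parallel steps: contraction of any set, possibly infinite, of redexes at pairwise parallel
positions. At the root, either a rule is applied or the parallel step goes on in the immediate
subterms. -/
def Par (R : ITRS S V) (s t : ITerm S V) : Prop :=
  ∃ X : ITerm S V → ITerm S V → Prop,
    (∀ a b, X a b → (∃ ρ ∈ R, RootStep ρ a b) ∨ Lift X a b) ∧ X s t

namespace Par

theorem unfold {s t : ITerm S V} (h : Par R s t) :
    (∃ ρ ∈ R, RootStep ρ s t) ∨ Lift (Par R) s t := by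
  obtain ⟨X, hX, h⟩ := h
  exact (hX _ _ h).imp_right fun h => h.mono fun a b hab => ⟨X, hX, hab⟩

theorem coind (X : ITerm S V → ITerm S V → Prop)
    (hX : ∀ a b, X a b → (∃ ρ ∈ R, RootStep ρ a b) ∨ Lift (fun c d => X c d ∨ Par R c d) a b)
    {s t : ITerm S V} (h : X s t) : Par R s t := by
  refine ⟨fun a b => X a b ∨ Par R a b, ?_, Or.inl h⟩
  rintro a b (h | h)
  · exact hX a b h
  · exact h.unfold.imp_right fun h => h.mono fun _ _ => Or.inr

theorem refl (s : ITerm S V) : Par R s s :=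
  coind (fun a b => a = b) (fun a _ h => Or.inr (h ▸ Lift.refl (fun _ => Or.inl rfl) a)) rfl

theorem of_lift {s t : ITerm S V} (h : Lift (Par R) s t) : Par R s t :=
  coind (fun a b => Lift (Par R) a b) (fun _ _ h => Or.inr (h.mono fun _ _ => Or.inr)) h

theorem of_rootStep {ρ : Rule S V} (hρ : ρ ∈ R) {s t : ITerm S V} (h : RootStep ρ s t) :
    Par R s t :=
  coind (fun a b => RootStep ρ a b) (fun _ _ h => Or.inl ⟨ρ, hρ, h⟩) h

theorem of_step {s t : ITerm S V} (h : StepGE R 0 s t) : Par R s t := by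
  obtain ⟨p, -, h⟩ := h
  induction p generalizing s t with
  | nil =>
    obtain ⟨ρ, hρ, h⟩ := stepAt_nil.1 h
    exact of_rootStep hρ h
  | cons i p ih =>
    obtain ⟨f, a, j, b, rfl, h1, rfl, rfl⟩ := stepAt_cons.1 h
    refine of_lift (.app f fun k => ?_)
    rcases eq_or_ne k j with rfl | hk
    · simpa using ih h1
    · simpa [hk] using refl _

theorem red {s t : ITerm S V} (h : Par R s t) : Red R s t := by
  refine Red.coind (Par R) (fun a b h => ?_) h
  rcases h.unfold with ⟨ρ, hρ, h⟩ | h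
  · exact ⟨b, .single ⟨[], le_rfl, stepAt_nil.2 ⟨ρ, hρ, h⟩⟩, Lift.refl (fun _ => Or.inl (refl _)) b⟩
  · exact ⟨a, .refl, h.mono fun _ _ => Or.inl⟩

theorem subst {σ τ : V → ITerm S V} (h : ∀ x, Par R (σ x) (τ x)) (t : ITerm S V) :
    Par R (t.subst σ) (t.subst τ) := by
  refine coind (fun a b => ∃ t : ITerm S V, a = t.subst σ ∧ b = t.subst τ) ?_ ⟨t, rfl, rfl⟩
  rintro _ _ ⟨t, rfl, rfl⟩
  rcases t.eq_var_or_app with ⟨x, rfl⟩ | ⟨f, a, rfl⟩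
  · simpa using (h x).unfold.imp_right fun h => h.mono fun _ _ => Or.inr
  · exact Or.inr (by simpa [lift_app] using fun i => Or.inl ⟨a i, rfl, rfl⟩)

end Par

theorem lift_par_of_stepGE {s t : ITerm S V} (h : StepGE R 1 s t) : Lift (Par R) s t := by
  obtain ⟨f, a, i, b, h1, rfl, rfl⟩ := h.eq_app
  refine .app f fun k => ?_
  rcases eq_or_ne k i with rfl | hk
  · simpa using Par.of_step h1
  · simpa [hk] using Par.refl _

/-- In an instance of a term that is not a variable, changes of the substitution take place below
the root. This is what the absence of collapsing rules is used for. -/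
theorem lift_subst {X : ITerm S V → ITerm S V → Prop}
    (hX : ∀ (σ τ : V → ITerm S V) (t : ITerm S V), (∀ x, X (σ x) (τ x)) →
      X (t.subst σ) (t.subst τ))
    {σ τ : V → ITerm S V} (h : ∀ x, X (σ x) (τ x)) {t : ITerm S V} (ht : ∀ x, t ≠ ITerm.var x) :
    Lift X (t.subst σ) (t.subst τ) := by
  rcases t.eq_var_or_app with ⟨x, rfl⟩ | ⟨f, a, rfl⟩
  · exact (ht x rfl).elim
  · simpa [lift_app] using fun i => hX σ τ (a i) h

/-- `t` is reached from the instance of the pattern `l` by `σ` by contracting a redex whose root is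
in the pattern, and then going on by `X`. -/
def PatternStep (R : ITRS S V) (l : Term S V) (σ : V → ITerm S V)
    (X : ITerm S V → ITerm S V → Prop) (t : ITerm S V) : Prop :=
  ∃ (p : List ℕ) (f : S.Symb) (ts : Fin (S.arity f) → Term S V) (v v' : ITerm S V),
    l.subtermAt p = some (Term.app f ts) ∧ (l.toITerm.subst σ).IsSubtermAt p v ∧
    (∃ ρ ∈ R, RootStep ρ v v') ∧ X ((l.toITerm.subst σ).replaceAt p v') t

namespace Term.Linear

theorem lift_par_subst_of_args {f : S.Symb} {ts : Fin (S.arity f) → Term S V}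
    (hl : (Term.app f ts).Linear) {σ : V → ITerm S V}
    (ih : ∀ i b, Par R ((ts i).toITerm.subst σ) b →
      (∃ τ : V → ITerm S V, b = (ts i).toITerm.subst τ ∧ ∀ x, Par R (σ x) (τ x)) ∨
        PatternStep R (ts i) σ (Par R) b)
    {t : ITerm S V} (h : Lift (Par R) ((Term.app f ts).toITerm.subst σ) t) :
    (∃ τ : V → ITerm S V, t = (Term.app f ts).toITerm.subst τ ∧ ∀ x, Par R (σ x) (τ x)) ∨
      PatternStep R (Term.app f ts) σ (Lift (Par R)) t := by
  simp only [toITerm_app, subst_app] at h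
  obtain ⟨b, rfl, hb⟩ := lift_app_left.1 h
  by_cases hstep : ∃ i, PatternStep R (ts i) σ (Par R) (b i)
  · obtain ⟨i, p, g, us, v, v', h1, h2, h3, h4⟩ := hstep
    refine Or.inr ⟨i.1 :: p, g, us, v, v', by simpa [Term.subtermAt] using h1, ?_, h3, ?_⟩
    · simpa [isSubtermAt_fin] using h2
    · simp only [toITerm_app, subst_app, replaceAt_fin]
      refine .app f fun j => ?_
      rcases eq_or_ne j i with rfl | hj
      · simpa using h4
      · simpa [hj] using hb j
  · choose τ h1 h2 using fun i => (ih i _ (hb i)).resolve_right fun h => hstep ⟨i, h⟩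
    obtain ⟨ν, h3, h4⟩ := hl.exists_glue τ σ
    refine Or.inl ⟨ν, ?_, fun x => ?_⟩
    · simp only [toITerm_app, subst_app, ITerm.app_inj]
      funext i
      rw [h1 i, toITerm_subst_congr (h3 i)]
    · rcases h4 x with h5 | ⟨i, h5⟩
      · exact h5 ▸ Par.refl _
      · exact h5 ▸ h2 i x

/-- A parallel step from an instance of a linear pattern either takes place in the
substitution, or contracts a redex whose root is in the pattern. In the latter case, that redex can
be contracted before the others. -/
theorem par_subst {l : Term S V} (hl : l.Linear) {σ : V → ITerm S V} {t : ITerm S V}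
    (h : Par R (l.toITerm.subst σ) t) :
    (∃ τ : V → ITerm S V, t = l.toITerm.subst τ ∧ ∀ x, Par R (σ x) (τ x)) ∨
      PatternStep R l σ (Par R) t := by
  classical
  induction l generalizing t with
  | var y =>
    refine Or.inl ⟨Function.update σ y t, by simp, fun x => ?_⟩
    rcases eq_or_ne x y with rfl | hx
    · simpa using h
    · simpa [hx] using Par.refl _
  | app f ts ih =>
    rcases h.unfold with h | h
    · exact Or.inr ⟨[], f, ts, _, t, rfl, isSubtermAt_nil.2 rfl, h,
        by simpa [replaceAt_nil] using Par.refl _⟩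
    · refine (hl.lift_par_subst_of_args (fun i b hb => ih i (hl.arg i) hb) h).imp_right ?_
      rintro ⟨p, g, us, v, v', h1, h2, h3, h4⟩
      exact ⟨p, g, us, v, v', h1, h2, h3, Par.of_lift h4⟩

theorem lift_par_subst {f : S.Symb} {ts : Fin (S.arity f) → Term S V}
    (hl : (Term.app f ts).Linear) {σ : V → ITerm S V} {t : ITerm S V}
    (h : Lift (Par R) ((Term.app f ts).toITerm.subst σ) t) :
    (∃ τ : V → ITerm S V, t = (Term.app f ts).toITerm.subst τ ∧ ∀ x, Par R (σ x) (τ x)) ∨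
      PatternStep R (Term.app f ts) σ (Lift (Par R)) t :=
  hl.lift_par_subst_of_args (fun i _ hb => (hl.arg i).par_subst hb) h

end Term.Linear

/-- A parallel step below the root and a step at the root. If the parallel step
contracts a redex that overlaps the one at the root, this has the effect of the step at the root,
and only the remaining redexes of the parallel step, all below the root, have to be contracted.
Otherwise the parallel step takes place in the substitution, and the redex at the root remains.
Since the rules do not collapse, the redexes below the root stay below the root. -/
theorem WeaklyOrthogonal.lift_par_rootStep [Infinite V] (hR : WeaklyOrthogonal R)
    (hnc : ∀ ρ ∈ R, ¬ ρ.Collapsing) {ρ : Rule S V} (hρ : ρ ∈ R) {s a b : ITerm S V}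
    (ha : Lift (Par R) s a) (hb : RootStep ρ s b) :
    ∃ w, (RootStep ρ a w ∨ Lift (Par R) a w) ∧ Lift (Par R) b w := by
  obtain ⟨σ, rfl, rfl⟩ := hb
  have key : (∃ τ : V → ITerm S V, a = ρ.lhs.toITerm.subst τ ∧ ∀ x, Par R (σ x) (τ x)) ∨
      PatternStep R ρ.lhs σ (Lift (Par R)) a := by
    have hlin := hR.1 ρ hρ
    obtain ⟨f, ts, hf⟩ := ρ.lhs_eq_app
    rw [hf] at hlin ha ⊢
    exact hlin.lift_par_subst ha
  rcases key with ⟨τ, rfl, hτ⟩ | ⟨p, f, ts, v, v', h1, h2, ⟨ρ', hρ', h3⟩, h4⟩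
  · exact ⟨_, Or.inl ⟨τ, rfl, rfl⟩,
      lift_subst (fun _ _ t h => Par.subst h t) hτ fun x hx => hnc ρ hρ ⟨x, hx⟩⟩
  · refine ⟨a, Or.inr (Lift.refl Par.refl a), ?_⟩
    rwa [hR.replaceAt_eq hρ hρ' h1 h2 h3] at h4

/-- Parallel steps have the diamond property. -/
theorem WeaklyOrthogonal.par_diamond [Infinite V] (hR : WeaklyOrthogonal R)
    (hnc : ∀ ρ ∈ R, ¬ ρ.Collapsing) {s a b : ITerm S V} (ha : Par R s a) (hb : Par R s b) :
    ∃ w, Par R a w ∧ Par R b w := by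
  let Q := {y : ITerm S V × ITerm S V // ∃ s, Par R s y.1 ∧ Par R s y.2}
  obtain ⟨F, hF⟩ := exists_corec (ι := Q) (fun y t => Par R y.1.1 t ∧ Par R y.1.2 t)
    (fun y f k => y.1.1 = ITerm.app f (fun i => (k i).1.1) ∧
      y.1.2 = ITerm.app f (fun i => (k i).1.2)) (by
    rintro ⟨⟨a, b⟩, s, ha, hb⟩
    dsimp only at ha hb ⊢
    rcases ha.unfold with ⟨ρ, hρ, ha⟩ | ha <;> rcases hb.unfold with ⟨ρ', hρ', hb⟩ | hb
    · exact Or.inl ⟨a, Par.refl a, hR.rootStep_unique hρ hρ' ha hb ▸ Par.refl a⟩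
    · obtain ⟨w, h1, h2⟩ := hR.lift_par_rootStep hnc hρ hb ha
      exact Or.inl ⟨w, Par.of_lift h2, h1.elim (Par.of_rootStep hρ) Par.of_lift⟩
    · obtain ⟨w, h1, h2⟩ := hR.lift_par_rootStep hnc hρ' ha hb
      exact Or.inl ⟨w, h1.elim (Par.of_rootStep hρ') Par.of_lift, Par.of_lift h2⟩
    · cases ha with
      | var x => exact Or.inl ⟨b, Par.of_lift hb, Par.refl b⟩
      | @app f s a ha' =>
        obtain ⟨b, rfl, hb'⟩ := lift_app_left.1 hb
        exact Or.inr ⟨f, fun i => ⟨(a i, b i), s i, ha' i, hb' i⟩, rfl, rfl⟩)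
  refine ⟨F ⟨(a, b), s, ha, hb⟩, ?_, ?_⟩
  · refine Par.coind (fun c d => ∃ y : Q, c = y.1.1 ∧ d = F y) ?_ ⟨⟨(a, b), s, ha, hb⟩, rfl, rfl⟩
    rintro _ _ ⟨y, rfl, rfl⟩
    rcases hF y with h | ⟨f, k, ⟨h1, -⟩, h2⟩
    · exact h.1.unfold.imp_right fun h => h.mono fun _ _ => Or.inr
    · rw [h1, h2]
      exact Or.inr (.app f fun i => Or.inl ⟨k i, rfl, rfl⟩)
  · refine Par.coind (fun c d => ∃ y : Q, c = y.1.2 ∧ d = F y) ?_ ⟨⟨(a, b), s, ha, hb⟩, rfl, rfl⟩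
    rintro _ _ ⟨y, rfl, rfl⟩
    rcases hF y with h | ⟨f, k, ⟨-, h1⟩, h2⟩
    · exact h.2.unfold.imp_right fun h => h.mono fun _ _ => Or.inr
    · rw [h1, h2]
      exact Or.inr (.app f fun i => Or.inl ⟨k i, rfl, rfl⟩)

theorem WeaklyOrthogonal.lift_par_diamond [Infinite V] (hR : WeaklyOrthogonal R)
    (hnc : ∀ ρ ∈ R, ¬ ρ.Collapsing) {s a b : ITerm S V} (ha : Lift (Par R) s a)
    (hb : Lift (Par R) s b) : ∃ w, Lift (Par R) a w ∧ Lift (Par R) b w := by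
  cases ha with
  | var x => exact ⟨b, hb, Lift.refl Par.refl b⟩
  | @app f s a ha' =>
    obtain ⟨b, rfl, hb'⟩ := lift_app_left.1 hb
    choose w h1 h2 using fun i => hR.par_diamond hnc (ha' i) (hb' i)
    exact ⟨ITerm.app f w, .app f h1, .app f h2⟩

/-! ### Projection of infinitary reductions over parallel steps -/

theorem lift_red_of_reflTransGen_lift_par (hR : WeaklyOrthogonal R) {s t : ITerm S V}
    (h : ReflTransGen (Lift (Par R)) s t) : Lift (Red R) s t := by
  induction h with
  | refl => exact Lift.refl Red.refl s
  | tail _ h ih => exact ih.comp (fun _ _ _ h1 h2 => h1.trans hR.1 h2) (h.mono fun _ _ => Par.red)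

/-- Steps below the root, projected over a step at the root. -/
theorem WeaklyOrthogonal.reflTransGen_lift_par_rootStep [Infinite V] (hR : WeaklyOrthogonal R)
    (hnc : ∀ ρ ∈ R, ¬ ρ.Collapsing) {ρ : Rule S V} (hρ : ρ ∈ R) {s a b : ITerm S V}
    (ha : ReflTransGen (Lift (Par R)) s a) (hb : RootStep ρ s b) :
    ∃ w, (RootStep ρ a w ∨ Lift (Par R) a w) ∧ ReflTransGen (Lift (Par R)) b w := by
  induction ha with
  | refl => exact ⟨b, Or.inl hb, .refl⟩
  | @tail a a' _ h ih =>
    obtain ⟨w, h1 | h1, h2⟩ := ih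
    · obtain ⟨w', h3, h4⟩ := hR.lift_par_rootStep hnc hρ h h1
      exact ⟨w', h3, h2.tail h4⟩
    · obtain ⟨w', h3, h4⟩ := hR.lift_par_diamond hnc h h1
      exact ⟨w', Or.inr h3, h2.tail h4⟩

/-- The root of the projection of an infinitary reduction below the root over a parallel
step. If the parallel step is a step at the root that is not removed by a finite part of the
reduction long enough to fix the redex pattern, then it remains as a step of the limit. Otherwise,
all that remains after that part is a parallel step below the root. -/
theorem WeaklyOrthogonal.exists_project_root [Infinite V] (hR : WeaklyOrthogonal R)
    (hnc : ∀ ρ ∈ R, ¬ ρ.Collapsing) {s t a : ITerm S V} (ht : Lift (Red R) s t)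
    (ha : Par R s a) :
    (∃ t', Par R t t' ∧ Lift (Red R) a t') ∨
      ∃ s' a', Lift (Red R) s' t ∧ Lift (Par R) s' a' ∧ Lift (Red R) a a' := by
  rcases ha.unfold with ⟨ρ, hρ, ha⟩ | ha
  · obtain ⟨s', h1, h2⟩ := LiftN.unfold_add (d := 1) ht ρ.lhs.depth
    obtain ⟨w, h3 | h3, h4⟩ := hR.reflTransGen_lift_par_rootStep hnc hρ
      (ReflTransGen.mono (fun _ _ => lift_par_of_stepGE) _ _ h1) ha
    · obtain ⟨σ, rfl, rfl⟩ := h3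
      obtain ⟨τ, rfl, h5⟩ := (hR.1 ρ hρ).exists_subst_of_liftN Red.refl
        (fun _ _ => Red.of_lift) (Nat.le_add_left _ 1) h2
      have h6 : Lift (Red R) (ρ.rhs.subst σ) (ρ.rhs.subst τ) :=
        lift_subst (fun _ _ t h => Red.subst h t) h5 fun x hx => hnc ρ hρ ⟨x, hx⟩
      exact Or.inl ⟨_, Par.of_rootStep hρ ⟨τ, rfl, rfl⟩,
        (lift_red_of_reflTransGen_lift_par hR h4).comp (fun _ _ _ h1 h2 => h1.trans hR.1 h2) h6⟩
    · rw [Nat.add_comm] at h2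
      exact Or.inr ⟨s', w, Lift.mono (fun _ _ h => h.fold fun _ _ => Red.of_lift) h2, h3,
        lift_red_of_reflTransGen_lift_par hR h4⟩
  · exact Or.inr ⟨s, a, ht, ha, Lift.refl Red.refl a⟩

theorem WeaklyOrthogonal.confluent_par [Infinite V] (hR : WeaklyOrthogonal R)
    (hnc : ∀ ρ ∈ R, ¬ ρ.Collapsing) {s a b : ITerm S V} (ha : ReflTransGen (Par R) s a)
    (hb : ReflTransGen (Par R) s b) :
    ∃ w, ReflTransGen (Par R) a w ∧ ReflTransGen (Par R) b w :=
  church_rosser (fun _ _ _ h1 h2 =>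
    let ⟨w, h3, h4⟩ := hR.par_diamond hnc h1 h2
    ⟨w, .single h3, .single h4⟩) ha hb

theorem reflTransGen_par_of_steps {s t : ITerm S V} (h : ReflTransGen (StepGE R 0) s t) :
    ReflTransGen (Par R) s t :=
  ReflTransGen.mono (fun _ _ => Par.of_step) _ _ h

/-- An infinitary reduction and a parallel step from the same term can be joined by a
parallel step and an infinitary reduction. -/
theorem WeaklyOrthogonal.red_par [Infinite V] (hR : WeaklyOrthogonal R)
    (hnc : ∀ ρ ∈ R, ¬ ρ.Collapsing) {s t a : ITerm S V} (ht : Red R s t) (ha : Par R s a) :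
    ∃ t', Par R t t' ∧ Red R a t' := by
  let Q := {y : ITerm S V × ITerm S V // ∃ s, Red R s y.1 ∧ Par R s y.2}
  obtain ⟨F, hF⟩ := exists_corec (ι := Q) (fun y t' => Par R y.1.1 t' ∧ Red R y.1.2 t')
    (fun y f k => y.1.1 = ITerm.app f (fun i => (k i).1.1) ∧
      Red R y.1.2 (ITerm.app f (fun i => (k i).1.2))) (by
    rintro ⟨⟨t, a⟩, s, ht, ha⟩
    dsimp only at ht ha ⊢
    obtain ⟨s₁, h1, h2⟩ := ht.unfold
    obtain ⟨a₁, h3, h4⟩ : ∃ a₁, Par R s₁ a₁ ∧ Red R a a₁ := by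
      clear h2
      induction h1 with
      | refl => exact ⟨a, ha, Red.refl a⟩
      | tail _ h ih =>
        obtain ⟨a₁, h3, h4⟩ := ih
        obtain ⟨w, h5, h6⟩ := hR.par_diamond hnc (Par.of_step h) h3
        exact ⟨w, h5, h4.trans hR.1 h6.red⟩
    rcases hR.exists_project_root hnc h2 h3 with ⟨t', h5, h6⟩ | ⟨s', a', h5, h6, h7⟩
    · exact Or.inl ⟨t', h5, h4.trans hR.1 (Red.of_lift h6)⟩
    · have h8 : Red R a a' := h4.trans hR.1 (Red.of_lift h7)
      cases h5 with
      | var x =>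
        exact Or.inl ⟨a', Par.of_lift h6, h8⟩
      | @app f s' t h5 =>
        obtain ⟨a', rfl, h9⟩ := lift_app_left.1 h6
        exact Or.inr ⟨f, fun i => ⟨(t i, a' i), s' i, h5 i, h9 i⟩, rfl, h8⟩)
  refine ⟨F ⟨(t, a), s, ht, ha⟩, ?_, ?_⟩
  · refine Par.coind (fun c d => ∃ y : Q, c = y.1.1 ∧ d = F y) ?_ ⟨⟨(t, a), s, ht, ha⟩, rfl, rfl⟩
    rintro _ _ ⟨y, rfl, rfl⟩
    rcases hF y with h | ⟨f, k, ⟨h1, -⟩, h2⟩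
    · exact h.1.unfold.imp_right fun h => h.mono fun _ _ => Or.inr
    · rw [h1, h2]
      exact Or.inr (.app f fun i => Or.inl ⟨k i, rfl, rfl⟩)
  · refine Red.coind_trans hR.1 (fun c d => ∃ y : Q, c = y.1.2 ∧ d = F y) ?_
      ⟨⟨(t, a), s, ht, ha⟩, rfl, rfl⟩
    rintro _ _ ⟨y, rfl, rfl⟩
    rcases hF y with h | ⟨f, k, ⟨-, h1⟩, h2⟩
    · exact ⟨F y, h.2, Lift.refl (fun _ => Or.inr (Red.refl _)) _⟩
    · rw [h2]
      exact ⟨_, h1, .app f fun i => Or.inl ⟨k i, rfl, rfl⟩⟩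

/-- If the infinitary reduction is below the root, then so is its projection. -/
theorem WeaklyOrthogonal.lift_red_par [Infinite V] (hR : WeaklyOrthogonal R)
    (hnc : ∀ ρ ∈ R, ¬ ρ.Collapsing) {s t a : ITerm S V} (ht : Lift (Red R) s t)
    (ha : Par R s a) : ∃ t', Par R t t' ∧ Lift (Red R) a t' := by
  rcases hR.exists_project_root hnc ht ha with h | ⟨s', a', h1, h2, h3⟩
  · exact h
  · cases h1 with
    | var x => exact ⟨a', Par.of_lift h2, h3⟩
    | @app f s' t h1 =>
      obtain ⟨a', rfl, h6⟩ := lift_app_left.1 h2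
      choose t' h4 h5 using fun i => hR.red_par hnc (h1 i) (h6 i)
      exact ⟨ITerm.app f t', Par.of_lift (.app f h4),
        h3.comp (fun _ _ _ h1 h2 => h1.trans hR.1 h2) (.app f h5)⟩

theorem WeaklyOrthogonal.lift_red_pars [Infinite V] (hR : WeaklyOrthogonal R)
    (hnc : ∀ ρ ∈ R, ¬ ρ.Collapsing) {s t a : ITerm S V} (ht : Lift (Red R) s t)
    (ha : ReflTransGen (Par R) s a) : ∃ t', Red R t t' ∧ Lift (Red R) a t' := by
  induction ha with
  | refl => exact ⟨t, Red.refl t, ht⟩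
  | tail _ h ih =>
    obtain ⟨t', h1, h2⟩ := ih
    obtain ⟨t'', h3, h4⟩ := hR.lift_red_par hnc h2 h
    exact ⟨t'', h1.trans hR.1 h3.red, h4⟩

/-! ### Infinitary confluence -/

/-- Infinitary reductions from the same term can be joined. Finite parts of them fix the root
symbols of the limits and can be joined by parallel steps. The remainders, projected over
these, are reductions below the root of one and the same term, so that the root symbol of the
common reduct is found, and its immediate subterms are found in the same way. -/
theorem WeaklyOrthogonal.confluent_red [Infinite V] (hR : WeaklyOrthogonal R)
    (hnc : ∀ ρ ∈ R, ¬ ρ.Collapsing) {s a b : ITerm S V} (ha : Red R s a) (hb : Red R s b) :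
    ∃ w, Red R a w ∧ Red R b w := by
  let Q := {y : ITerm S V × ITerm S V // ∃ s, Red R s y.1 ∧ Red R s y.2}
  obtain ⟨F, hF⟩ := exists_corec (ι := Q) (fun y t => Red R y.1.1 t ∧ Red R y.1.2 t)
    (fun y f k => Red R y.1.1 (ITerm.app f (fun i => (k i).1.1)) ∧
      Red R y.1.2 (ITerm.app f (fun i => (k i).1.2))) (by
    rintro ⟨⟨a, b⟩, s, ha, hb⟩
    dsimp only at ha hb ⊢
    obtain ⟨s₁, h1, h2⟩ := ha.unfold
    obtain ⟨s₂, h3, h4⟩ := hb.unfold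
    obtain ⟨w, h5, h6⟩ := hR.confluent_par hnc (reflTransGen_par_of_steps h1)
      (reflTransGen_par_of_steps h3)
    obtain ⟨a', h7, h8⟩ := hR.lift_red_pars hnc h2 h5
    obtain ⟨b', h9, h10⟩ := hR.lift_red_pars hnc h4 h6
    cases h8 with
    | var x => exact Or.inl ⟨b', h7.trans hR.1 (Red.of_lift h10), h9⟩
    | @app f w a' h8 =>
      obtain ⟨b', rfl, h11⟩ := lift_app_left.1 h10
      exact Or.inr ⟨f, fun i => ⟨(a' i, b' i), w i, h8 i, h11 i⟩, h7, h9⟩)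
  refine ⟨F ⟨(a, b), s, ha, hb⟩, ?_, ?_⟩
  · refine Red.coind_trans hR.1 (fun c d => ∃ y : Q, c = y.1.1 ∧ d = F y) ?_
      ⟨⟨(a, b), s, ha, hb⟩, rfl, rfl⟩
    rintro _ _ ⟨y, rfl, rfl⟩
    rcases hF y with h | ⟨f, k, ⟨h1, -⟩, h2⟩
    · exact ⟨F y, h.1, Lift.refl (fun _ => Or.inr (Red.refl _)) _⟩
    · rw [h2]
      exact ⟨_, h1, .app f fun i => Or.inl ⟨k i, rfl, rfl⟩⟩
  · refine Red.coind_trans hR.1 (fun c d => ∃ y : Q, c = y.1.2 ∧ d = F y) ?_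
      ⟨⟨(a, b), s, ha, hb⟩, rfl, rfl⟩
    rintro _ _ ⟨y, rfl, rfl⟩
    rcases hF y with h | ⟨f, k, ⟨-, h1⟩, h2⟩
    · exact ⟨F y, h.2, Lift.refl (fun _ => Or.inr (Red.refl _)) _⟩
    · rw [h2]
      exact ⟨_, h1, .app f fun i => Or.inl ⟨k i, rfl, rfl⟩⟩

theorem InfReduces.eq_of_isNormalForm {s t : ITerm S V} (h : InfReduces R s t)
    (hs : IsNormalForm R s) : s = t := by
  obtain ⟨α, x, p, hx, rfl, rfl⟩ := h
  rcases eq_zero_or_pos α with rfl | hα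
  · rfl
  · exact (hs ⟨_, _, hx.step 0 hα⟩).elim

end InfRewriting

theorem mainTheorem1 {S : InfRewriting.Signature} {V : Type*} [Infinite V]
    (R : InfRewriting.ITRS S V) (hR : InfRewriting.WeaklyOrthogonal R)
    (hnc : ∀ ρ ∈ R, ¬ ρ.Collapsing) :
    InfRewriting.CRinf R ∧ InfRewriting.UNinf R := by
  have hCR : InfRewriting.CRinf R := fun s t₁ t₂ h₁ h₂ =>
    let ⟨w, h3, h4⟩ := hR.confluent_red hnc (h₁.red hR.1) (h₂.red hR.1)
    ⟨w, h3.infReduces, h4.infReduces⟩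
  refine ⟨hCR, fun s t₁ t₂ h₁ h₂ hn₁ hn₂ => ?_⟩
  obtain ⟨u, h3, h4⟩ := hCR s t₁ t₂ h₁ h₂
  rw [h3.eq_of_isNormalForm hn₁, h4.eq_of_isNormalForm hn₂]
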